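/- \textbf{Setting.} Let $d,q,R\ge 1$ and $m\ge 0$ be integers, $a<b$, $s>0$, $\delta>0$ real numbers and $\varphi,\chi:\mathbb R\to\mathbb R$ functions. Let $\mathcal M=\{a,a+\Delta x,\dots,b-\Delta x\}^d$ with $\Delta x=(b-a)/2^q$; a mesh point $x$ with coordinates $x_j=a+l_j\Delta x$ is encoded by the basis state $|l_1,\dots,l_d\rangle$ of $d$ registers of $q$ qubits. For $f:\mathbb R^d\to\mathbb R$ put $\mathbf V|x\rangle=f(x)|x\rangle$. Let $\mathbf L$ be the diagonal operator with $\mathbf L|k_1,\dots,k_d\rangle=\frac12\sum_{j}\big(\tfrac{2\pi(k_j-2^{q-1})}{b-a}\big)^2|k_1,\dots,k_d\rangle$ and $\mathbf F_s$ the quantum shifted Fourier transform, $\mathbf F_s|k_1,\dots,k_d\rangle=\bigotimes_j 2^{-q/2}\sum_{l=0}^{2^q-1}e^{2\pi i(k_j-2^{q-1})l/2^q}|l\rangle$. The product-formula implementation of Quantum Hamiltonian Descent starts from $|0\rangle^{\otimes dq}$, prepares a state $|\psi_0\rangle$, computes $$|\psi_{j+1}\rangle=\mathbf F_s\,e^{-is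 e^{\varphi(js)}\mathbf L}\,\mathbf F_s^{-1}\,e^{-is e^{\chi(js)}\mathbf V}|\psi_j\rangle,\qquad j=0,\dots,R-1,$$ and measures $|\psi_R\rangle$ in the computational basis. \textbf{Cost model.} The machine has these $dq$ qubits, an $m$-qubit value register and any sufficiently large number of work qubits, all initially $0$. Its elementary operations (``gates'') are arbitrary one- and two-qubit unitaries and queries $O_f:|x,z\rangle\mapsto|x,z+F(x)\bmod 2^m\rangle$. Here $F(x)$ is an $m$-bit two's complement integer with $|f(x)-\delta F(x)|\le\eta$ for all $x\in\mathcal M$; thus $\eta=0$ if the values of $f$ on the mesh are exactly representable. Each gate, each query and each single-qubit measurement costs $1$. We assume that the value register has $m=\tilde O(dq)$ qubits. Precisely, $m\le K\,dq\,(\lfloor\log_2(dq)\rfloor+1)^K$ for a fixed integer $K\ge0$. \textbf{Theorem.} For every $K$ there are constants $C,k$, depending only on $K$, such that for all data as above there are circuits, which depend on the parameters but not on $f$, $F$ or $\eta$, with the following properties. (i) The circuits for $\mathbf F_s$, $\mathbf F_s^{-1}$ and $e^{-ise^{\varphi(js)}\mathbf L}$ make no query, perform these operators exactly, and return all other qubits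 to $0$. The circuit for $e^{-ise^{\chi(js)}\mathbf V}$ makes at most two queries and, applied to a state $|\psi\rangle$ of the $dq$ qubits (all other qubits $0$), is correct up to an error $s\,e^{\chi(js)}\eta\,\|\psi\|$ in norm. In particular it is exact if $\eta=0$. (ii) One iteration costs at most $C\,dq\,(\lfloor\log_2(dq)\rfloor+1)^k=\tilde O(dq)$ gates, and all $R$ iterations together cost at most $C\,dqR\,(\lfloor\log_2(dqR)\rfloor+1)^k=\tilde O(dqR)$ gates. (iii) If the initial state $|\psi_0\rangle$ is prepared from the all-zero state (all other qubits returned to $0$) by at most $K\,dqR\,(\lfloor\log_2(dqR)\rfloor+1)^K$ gates, then the whole algorithm, including the preparation, the $R$ iterations and the measurement of the $dq$ qubits, has gate complexity at most $C\,dqR\,(\lfloor\log_2(dqR)\rfloor+1)^k=\tilde O(dqR)$. The state before the measurement differs from $|\psi_R\rangle\otimes|0\rangle$ by at most $\varepsilon=\sum_{j<R}s\,e^{\chi(js)}\eta$ in norm, and the distribution of the measurement outcome differs from $x\mapsto|\langle x|\psi_R\rangle|^2$ by at most $2\varepsilon$ in $\ell^1$-norm. Moreover, the uniform superposition over $\mathcal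 M$ can be prepared by $dq$ gates. -/

import Mathlib

/-!
Quantum circuits over arbitrary one- and two-qubit gates with an evaluation oracle, and the
product-formula (pseudo-spectral) discretization of Quantum Hamiltonian Descent.
-/

namespace QHD

open scoped BigOperators Matrix

/-! ### Qubit registers and circuits -/

/-- Pure states (not necessarily normalized) of a register whose qubits are labelled by `ι`. -/
abbrev QState (ι : Type) [Fintype ι] : Type := EuclideanSpace ℂ (ι → Bool)

/-- The all-zero computational basis state. -/
noncomputable def zeroState (ι : Type) [Fintype ι] [DecidableEq ι] : QState ι :=
  EuclideanSpace.single (fun _ => false) 1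

/-- The qubits of the machine: `d` coordinate registers of `q` qubits each, the `m`-qubit value
register of the oracle, and `w` further work qubits. -/
abbrev Qubit (d q m w : ℕ) : Type := (Fin d × Fin q) ⊕ (Fin m ⊕ Fin w)

/-- Computational basis labels of the `d * q` coordinate qubits; they enumerate the mesh. -/
abbrev MeshIndex (d q : ℕ) : Type := Fin d × Fin q → Bool

/-- An elementary operation: an arbitrary one-qubit unitary, an arbitrary two-qubit unitary on two
different qubits, or one query to the evaluation oracle. -/
inductive Gate (d q m w : ℕ) : Type
  | one (i : Qubit d q m w) (U : Matrix.unitaryGroup Bool ℂ) : Gate d q m w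
  | two (i j : Qubit d q m w) (hij : i ≠ j) (U : Matrix.unitaryGroup (Bool × Bool) ℂ) :
      Gate d q m w
  | query : Gate d q m w

/-- The content of the value register after subtracting `v` modulo `2 ^ m`. -/
def subBits {m : ℕ} (z : Fin m → Bool) (v : BitVec m) : Fin m → Bool :=
  fun i => (BitVec.ofFnLE z - v).getLsb i

/-- The action of an elementary operation on amplitudes. The oracle holds an `m`-bit number `F x`
for every basis label `x` of the coordinate registers, and a query is the permutation
`|x, z, y⟩ ↦ |x, z + F x, y⟩` (addition modulo `2 ^ m`); so the new amplitude at `(x, z, y)` is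
the old amplitude at `(x, z - F x, y)`. -/
noncomputable def Gate.apply {d q m w : ℕ} (F : MeshIndex d q → BitVec m) :
    Gate d q m w → QState (Qubit d q m w) → QState (Qubit d q m w)
  | .one i U, ψ => WithLp.toLp 2 fun x =>
      ∑ c : Bool, U.1 (x i) c * ψ (Function.update x i c)
  | .two i j _ U, ψ => WithLp.toLp 2 fun x =>
      ∑ c : Bool × Bool, U.1 (x i, x j) c *
        ψ (Function.update (Function.update x i c.1) j c.2)
  | .query, ψ => WithLp.toLp 2 fun x =>
      ψ (Sum.elim (fun r => x (.inl r))
          (Sum.elim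
            (subBits (fun i => x (.inr (.inl i))) (F fun r => x (.inl r)))
            (fun i => x (.inr (.inr i)))))

/-- A circuit is a finite sequence of elementary operations, the first one being applied first. -/
abbrev Circuit (d q m w : ℕ) : Type := List (Gate d q m w)

/-- The action of a circuit on a state, the oracle being `F`. -/
noncomputable def run {d q m w : ℕ} (F : MeshIndex d q → BitVec m) (c : Circuit d q m w)
    (ψ : QState (Qubit d q m w)) : QState (Qubit d q m w) :=
  c.foldl (fun φ g => g.apply F φ) ψ

/-- The number of elementary operations of a circuit; an oracle query counts as one. -/
def gateCount {d q m w : ℕ} (c : Circuit d q m w) : ℕ := c.length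

/-- Whether an elementary operation is an oracle query. -/
def Gate.isQuery {d q m w : ℕ} : Gate d q m w → Bool
  | .query => true
  | _ => false

/-- The number of oracle queries of a circuit. -/
def queryCount {d q m w : ℕ} (c : Circuit d q m w) : ℕ := c.countP Gate.isQuery

/-- The state `|ψ⟩ ⊗ |0⟩`: coordinate registers in state `ψ`, all other qubits zero. -/
noncomputable def withZeros {d q m w : ℕ} (ψ : QState (Fin d × Fin q)) :
    QState (Qubit d q m w) :=
  WithLp.toLp 2 fun x =>
    if ∀ r, x (.inr r) = false then ψ (fun r => x (.inl r)) else 0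

/-- The probability of the outcome `x` when the coordinate qubits are measured in the
computational basis. -/
noncomputable def outcomeProb {d q m w : ℕ} (Ψ : QState (Qubit d q m w)) (x : MeshIndex d q) :
    ℝ :=
  ∑ y : Fin m ⊕ Fin w → Bool, ‖Ψ (Sum.elim x y)‖ ^ 2

/-! ### Discretized Quantum Hamiltonian Descent -/

/-- The integer in `{0, …, 2 ^ q - 1}` held by the register of coordinate `j`. -/
def coordVal {d q : ℕ} (x : MeshIndex d q) (j : Fin d) : ℕ :=
  ∑ i : Fin q, if x (j, i) then 2 ^ (i : ℕ) else 0

/-- The point of the regular mesh in `[a, b] ^ d`, with step `(b - a) / 2 ^ q`, that has the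
label `x`. -/
noncomputable def meshPoint {d q : ℕ} (a b : ℝ) (x : MeshIndex d q) : Fin d → ℝ :=
  fun j => a + coordVal x j * ((b - a) / 2 ^ q)

/-- The frequency in `{-2 ^ q / 2, …, 2 ^ q / 2 - 1}` that the register of coordinate `j` stands
for in the Fourier picture. -/
noncomputable def freq {d q : ℕ} (k : MeshIndex d q) (j : Fin d) : ℝ :=
  coordVal k j - 2 ^ q / 2

/-- The potential operator: `V |x⟩ = f(x) |x⟩` on the mesh. -/
noncomputable def potential {d q : ℕ} (a b : ℝ) (f : (Fin d → ℝ) → ℝ) :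
    Matrix (MeshIndex d q) (MeshIndex d q) ℂ :=
  Matrix.diagonal fun x => (f (meshPoint a b x) : ℂ)

/-- The diagonal operator `L` of eigenvalues of `-∇² / 2` on the periodic box `[a, b] ^ d`: the
Fourier mode with frequencies `κ` has eigenvalue `(1/2) ∑ j, (2 π κ j / (b - a)) ^ 2`. -/
noncomputable def kinetic (d q : ℕ) (a b : ℝ) : Matrix (MeshIndex d q) (MeshIndex d q) ℂ :=
  Matrix.diagonal fun k =>
    (((1 / 2 : ℝ) * ∑ j : Fin d, (2 * Real.pi * freq k j / (b - a)) ^ 2 : ℝ) : ℂ)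

/-- The quantum shifted Fourier transform, applied to each of the `d` coordinate registers:
`F_s |k⟩ = ⨂ j, 2 ^ (-q/2) ∑ l, exp (2 π i (k j - 2 ^ q / 2) l / 2 ^ q) |l⟩`. -/
noncomputable def qsft (d q : ℕ) : Matrix (MeshIndex d q) (MeshIndex d q) ℂ :=
  Matrix.of fun x k => ∏ j : Fin d,
    ((Real.sqrt (2 ^ q) : ℝ) : ℂ)⁻¹ *
      Complex.exp (2 * Real.pi * Complex.I * (freq k j : ℂ) * (coordVal x j : ℂ) / 2 ^ q)

/-- The potential phase `exp (-i s e^{χ(j s)} V)` of iteration `j`. -/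
noncomputable def potentialPhase {d q : ℕ} (a b s : ℝ) (χ : ℝ → ℝ) (f : (Fin d → ℝ) → ℝ)
    (j : ℕ) : Matrix (MeshIndex d q) (MeshIndex d q) ℂ :=
  NormedSpace.exp ((-(Complex.I * s * Real.exp (χ (j * s)))) • potential a b f)

/-- The kinetic phase `exp (-i s e^{φ(j s)} L)` of iteration `j`. -/
noncomputable def kineticPhase (d q : ℕ) (a b s : ℝ) (φ : ℝ → ℝ) (j : ℕ) :
    Matrix (MeshIndex d q) (MeshIndex d q) ℂ :=
  NormedSpace.exp ((-(Complex.I * s * Real.exp (φ (j * s)))) • kinetic d q a b)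

/-- A matrix acting on states of the coordinate registers. -/
noncomputable def act {d q : ℕ} (M : Matrix (MeshIndex d q) (MeshIndex d q) ℂ)
    (ψ : QState (Fin d × Fin q)) : QState (Fin d × Fin q) :=
  WithLp.toLp 2 (M *ᵥ ψ.ofLp)

/-- The iterates of the algorithm:
`ψ_{j+1} = F_s exp (-i s e^{φ(j s)} L) F_s⁻¹ exp (-i s e^{χ(j s)} V) ψ_j`. -/
noncomputable def iterate {d q : ℕ} (a b s : ℝ) (φ χ : ℝ → ℝ) (f : (Fin d → ℝ) → ℝ)
    (ψ₀ : QState (Fin d × Fin q)) : ℕ → QState (Fin d × Fin q)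
  | 0 => ψ₀
  | j + 1 => act (qsft d q * kineticPhase d q a b s φ j * (qsft d q)⁻¹ *
      potentialPhase a b s χ f j) (iterate a b s φ χ f ψ₀ j)

/-- The uniform superposition over the mesh. -/
noncomputable def uniformState (d q : ℕ) : QState (Fin d × Fin q) :=
  WithLp.toLp 2 fun _ => ((Real.sqrt (2 ^ (d * q)) : ℝ) : ℂ)⁻¹

/-- The circuit that runs, for `j = 0, …, R - 1` in this order, the potential phase, the inverse
Fourier transform, the kinetic phase and the Fourier transform. -/
def iterationCircuit {d q m w : ℕ} (pot kin : ℕ → Circuit d q m w) (ift ft : Circuit d q m w)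
    (R : ℕ) : Circuit d q m w :=
  (List.range R).flatMap fun j => pot j ++ ift ++ kin j ++ ft

/-- The circuit `c`, which must not query the oracle, performs the matrix `M` exactly on the
coordinate registers, and takes all other qubits from zero to zero. -/
def Implements {d q m w : ℕ} (c : Circuit d q m w)
    (M : Matrix (MeshIndex d q) (MeshIndex d q) ℂ) : Prop :=
  queryCount c = 0 ∧
    ∀ (F : MeshIndex d q → BitVec m) (ψ : QState (Fin d × Fin q)),
      run F c (withZeros ψ) = withZeros (act M ψ)

/-- The oracle `F` evaluates `f` on the mesh in `m`-bit two's complement fixed-point arithmetic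
with unit `δ`, up to an error of at most `η`. -/
def Evaluates {d q m : ℕ} (F : MeshIndex d q → BitVec m) (f : (Fin d → ℝ) → ℝ)
    (a b δ η : ℝ) : Prop :=
  ∀ x, |f (meshPoint a b x) - δ * ((F x).toInt : ℝ)| ≤ η

/-- The bound `C n (log n + 1) ^ k` behind the notation `Õ(n)`. -/
def softBound (C k n : ℕ) : ℕ := C * n * (Nat.log 2 n + 1) ^ k

end QHD

/-! The difficulty is an exact Fourier transform on `q` qubits with quasi-linearly many one- and
two-qubit gates. Splitting the register into a low and a high part factors the transform into two
smaller transforms with one twiddle phase `exp (i θ lo hi)` between them (`fourierBlock_add`);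
halving the register gives logarithmic depth. The square in the kinetic phase is a product phase
too. So everything rests on multiplying a basis state by `exp (i θ X Y)`, for integers `X`, `Y` held
by registers, in quasi-linear cost (`exists_phase_product`).

The product itself is never written into a register. By fast multiplication over antiperiodic
sequences (polynomials modulo `z ^ r + 1`, where powers of `z` serve as roots of unity, so that a
Fourier transform uses only additions, shifts and signs) one has `X Y = ∑ v, w v ⟨v, x⟩ ⟨v, y⟩`.
Here `x`, `y` are the bit vectors and `v` runs over quasi-linearly many integer vectors, all reached
from the unit vectors by quasi-linearly many additions (`exists_product_chain`). The weights `w v`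
are arbitrary reals, which is harmless, as they enter only as rotation angles. The forms `⟨v, x⟩`
are bounded by a power of two of size `O(q)`, so each fits into `O(log q)` qubits. They are computed
by adders in Fourier space (`exists_adder`), each pair contributes `O((log q) ^ 2)` two-qubit
phases, and the forms are then uncomputed.

The potential phase is linear in the bits of the value register: query, rotate each bit, and erase
the value by a second query between bit flips. Its only error comes from `F`; since all gates
preserve the norm, the errors of the iterations add up. The measurement bound follows from the
Cauchy–Schwarz inequality. -/

namespace QHD

open scoped BigOperators Matrix

/-! ### Chains of additions -/

section Chains

variable {V : Type} [AddCommGroup V]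

/-- The elements of a set and their negatives. -/
def signed (S : Set V) : Set V := {v | v ∈ S ∨ -v ∈ S}

theorem subset_signed (S : Set V) : S ⊆ signed S := fun _ h => Or.inl h

theorem neg_mem_signed {S : Set V} {v : V} (h : v ∈ signed S) : -v ∈ signed S := by
  rcases h with h | h
  · exact Or.inr (by simpa using h)
  · exact Or.inl h

theorem signed_mono {S T : Set V} (h : S ⊆ T) : signed S ⊆ signed T := fun _ hv =>
  hv.imp (fun x => h x) (fun x => h x)

theorem signed_subset {S T : Set V} (h : S ⊆ signed T) : signed S ⊆ signed T := fun v hv => by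
  rcases hv with hv | hv
  · exact h hv
  · simpa using neg_mem_signed (h hv)

/-- A list of vectors, the last one coming first, each of which is a sum of two vectors that
belong, up to sign, to `K` or to the preceding part of the list. -/
inductive AddChain (K : Set V) : List V → Prop
  | nil : AddChain K []
  | cons {l : List V} {a b : V} : AddChain K l → a ∈ signed (K ∪ {x | x ∈ l}) →
      b ∈ signed (K ∪ {x | x ∈ l}) → AddChain K ((a + b) :: l)

/-- A summand taken from `K'` is, up to sign, already present in `K` or `l`, so the second chain can
be run after the first without extra additions. -/
theorem AddChain.append {K K' : Set V} {l l' : List V} (h : AddChain K l)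
    (hK : K' ⊆ signed (K ∪ {x | x ∈ l})) (h' : AddChain K' l') : AddChain K (l' ++ l) := by
  induction h' with
  | nil => exact h
  | @cons l₁ a b _ ha hb ih =>
    have key : signed (K' ∪ {x | x ∈ l₁}) ⊆ signed (K ∪ {x | x ∈ l₁ ++ l}) := by
      apply signed_subset
      rintro x (hx | hx)
      · refine signed_mono ?_ (hK hx)
        rintro y (hy | hy)
        · exact Or.inl hy
        · exact Or.inr (List.mem_append_right _ hy)
      · exact Or.inl (Or.inr (List.mem_append_left _ hx))
    exact AddChain.cons ih (key ha) (key hb)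

/-- From `K` one can reach `K'`, up to sign, by at most `c` additions, all results being bounded
by `B`. -/
def Reach (ν : AddGroupSeminorm V) (B : ℝ) (K : Set V) (c : ℕ) (K' : Set V) : Prop :=
  ∃ l : List V, AddChain K l ∧ l.length ≤ c ∧ (∀ x ∈ l, ν x ≤ B) ∧
    K' ⊆ signed (K ∪ {x | x ∈ l})

variable {ν : AddGroupSeminorm V} {B : ℝ}

theorem Reach.of_subset {K K' : Set V} (h : K' ⊆ signed K) : Reach ν B K 0 K' :=
  ⟨[], AddChain.nil, le_rfl, by simp, h.trans (signed_mono Set.subset_union_left)⟩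

/-- The intermediate set is kept in the result because computed vectors remain available. -/
theorem Reach.trans {K K' K'' : Set V} {c c' : ℕ} (h : Reach ν B K c K')
    (h' : Reach ν B K' c' K'') : Reach ν B K (c + c') (K' ∪ K'') := by
  obtain ⟨l, hl, hc, hB, hK⟩ := h
  obtain ⟨l', hl', hc', hB', hK'⟩ := h'
  have key : K' ⊆ signed (K ∪ {x | x ∈ l' ++ l}) := hK.trans (signed_mono (by
    rintro y (hy | hy)
    · exact Or.inl hy
    · exact Or.inr (List.mem_append_right _ hy)))
  refine ⟨l' ++ l, hl.append hK hl', by simp; omega, ?_, ?_⟩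
  · intro x hx
    rcases List.mem_append.1 hx with hx | hx
    · exact hB' x hx
    · exact hB x hx
  · rintro x (hx | hx)
    · exact key hx
    · refine signed_subset ?_ (hK' hx)
      rintro y (hy | hy)
      · exact key hy
      · exact Or.inl (Or.inr (List.mem_append_left _ hy))

theorem Reach.mono {K K' K'' : Set V} {c c' : ℕ} {B' : ℝ} (h : Reach ν B K c K') (hc : c ≤ c')
    (hB : B ≤ B') (hK : K'' ⊆ signed K') : Reach ν B' K c' K'' := by
  obtain ⟨l, hl, hc', hB', hK'⟩ := h
  exact ⟨l, hl, hc'.trans hc, fun x hx => (hB' x hx).trans hB, hK.trans (signed_subset hK')⟩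

theorem Reach.weaken {K K₀ K' : Set V} {c : ℕ} (h : Reach ν B K₀ c K') (hK : K₀ ⊆ signed K) :
    Reach ν B K c K' := by
  have := (Reach.of_subset (ν := ν) (B := B) hK).trans h
  rw [Nat.zero_add] at this
  exact this.mono le_rfl le_rfl (Set.subset_union_right.trans (subset_signed _))

theorem Reach.union {K A A' : Set V} {c c' : ℕ} (h : Reach ν B K c A)
    (h' : Reach ν B K c' A') : Reach ν B K (c + c') (A ∪ A') := by
  have h1 : Reach ν B K c (A ∪ K) := by
    obtain ⟨l, hl, hc, hB, hK⟩ := h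
    exact ⟨l, hl, hc, hB, Set.union_subset hK (Set.subset_union_left.trans (subset_signed _))⟩
  have h2 : Reach ν B (A ∪ K) c' A' :=
    h'.weaken (Set.subset_union_right.trans (subset_signed _))
  refine (h1.trans h2).mono le_rfl le_rfl (Set.Subset.trans ?_ (subset_signed _))
  rintro x (hx | hx)
  · exact Or.inl (Or.inl hx)
  · exact Or.inr hx

theorem Reach.iUnion {K : Set V} {c n : ℕ} {A : ℕ → Set V}
    (h : ∀ i < n, Reach ν B K c (A i)) : Reach ν B K (n * c) {v | ∃ i < n, v ∈ A i} := by
  induction n with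
  | zero =>
    have : {v | ∃ i < 0, v ∈ A i} ⊆ signed K := by
      rintro x ⟨i, hi, _⟩
      omega
    exact (Reach.of_subset this).mono (by simp) le_rfl (subset_signed _)
  | succ n ih =>
    refine ((ih fun i hi => h i (by omega)).union (h n (by omega))).mono
      (by rw [Nat.succ_mul]) le_rfl (Set.Subset.trans ?_ (subset_signed _))
    rintro x ⟨i, hi, hx⟩
    rcases Nat.lt_succ_iff_lt_or_eq.1 hi with hi | hi
    · exact Or.inl ⟨i, hi, hx⟩
    · exact Or.inr (hi ▸ hx)

theorem Reach.add {K : Set V} {a b : V} (ha : a ∈ signed K) (hb : b ∈ signed K)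
    (hB : ν (a + b) ≤ B) : Reach ν B K 1 {a + b} := by
  refine ⟨[a + b], AddChain.cons AddChain.nil (signed_mono Set.subset_union_left ha)
    (signed_mono Set.subset_union_left hb), le_rfl, by simpa using hB, ?_⟩
  rintro x rfl
  exact Or.inl (Or.inr (by simp))

/-! ### The fast Fourier transform over the ring of antiperiodic sequences -/

theorem antiperiodic_mul {α : Type} [InvolutiveNeg α] {f : ℤ → α} {r : ℤ}
    (h : ∀ j, f (j + r) = -f j) (t : ℤ) : ∀ j, f (j + t * r) = f j ∨ f (j + t * r) = -f j := by
  induction t using Int.induction_on with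
  | zero => simp
  | succ i ih =>
    intro j
    have := h (j + i * r)
    rw [show j + ((i : ℤ) + 1) * r = j + i * r + r by ring, this]
    rcases ih j with e | e <;> rw [e] <;> simp
  | pred i ih =>
    intro j
    have := h (j + (-(i : ℤ) - 1) * r)
    rw [show j + (-(i : ℤ) - 1) * r + r = j + -(i : ℤ) * r by ring] at this
    rw [← neg_neg (f (j + (-(i : ℤ) - 1) * r)), ← this]
    rcases ih j with e | e <;> rw [e] <;> simp

theorem antiperiodic_two_mul {α : Type} [InvolutiveNeg α] {f : ℤ → α} {r : ℤ}
    (h : ∀ j, f (j + r) = -f j) (t : ℤ) (j : ℤ) : f (j + t * (2 * r)) = f j := by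
  have h2 : Function.Periodic f (2 * r) := fun j => by
    rw [two_mul, ← add_assoc, h, h, neg_neg]
  simpa using h2.int_mul t j

theorem sum_range_two_mul {M : Type*} [AddCommMonoid M] (f : ℕ → M) (n : ℕ) :
    ∑ a ∈ Finset.range (2 * n), f a
      = ∑ a ∈ Finset.range n, f (2 * a) + ∑ a ∈ Finset.range n, f (2 * a + 1) := by
  induction n with
  | zero => simp
  | succ n ih =>
    rw [show 2 * (n + 1) = 2 * n + 1 + 1 by ring, Finset.sum_range_succ, Finset.sum_range_succ,
      ih, Finset.sum_range_succ, Finset.sum_range_succ]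
    abel

theorem seminorm_sum_le (ν : AddGroupSeminorm V) {n : ℕ} {f : ℕ → V} {b : ℝ}
    (h : ∀ a < n, ν (f a) ≤ b) : ν (∑ a ∈ Finset.range n, f a) ≤ n * b := by
  induction n with
  | zero => simp
  | succ n ih =>
    rw [Finset.sum_range_succ]
    refine (map_add_le_add ν _ _).trans ?_
    push_cast
    linarith [ih fun a ha => h a (by omega), h n (by omega)]

/-- Modulo `z ^ r + 1` the monomial `z ^ e` is a root of unity of order `2 ^ (s + 1)`, and
multiplying by it is the shift by `e`. The sums are thus a discrete Fourier transform of `2 ^ s`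
sequences at `2 ^ (s + 1)` points. Splitting `a` by parity doubles `e`, and each level costs one
addition per entry; shifts and signs are free. -/
theorem reach_fft (s : ℕ) : ∀ (e r : ℕ), e * 2 ^ s = r → ∀ (U : ℕ → ℤ → V) (b : ℝ) (K : Set V),
    0 < r → 0 ≤ b → (∀ a j, U a (j + r) = -U a j) → (∀ a j, U a j ∈ signed K) →
    (∀ a j, ν (U a j) ≤ b) →
    Reach ν (2 ^ s * b) K (s * 2 ^ (s + 1) * r)
      {v | ∃ (i : ℕ) (j : ℤ), v = ∑ a ∈ Finset.range (2 ^ s), U a (j - e * i * a)} := by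
  induction s with
  | zero =>
    intro e r _ U b K _ _ _ hK _
    refine (Reach.of_subset ?_).mono (Nat.zero_le _) le_rfl (subset_signed _)
    rintro v ⟨i, j, rfl⟩
    simpa using hK 0 j
  | succ s ih =>
    intro e r he U b K hr hb hU hK hν
    have h0 := ih (2 * e) r (by rw [← he]; ring) (fun a => U (2 * a)) b K hr hb
      (fun a => hU _) (fun a => hK _) (fun a => hν _)
    have h1 := ih (2 * e) r (by rw [← he]; ring) (fun a => U (2 * a + 1)) b K hr hb
      (fun a => hU _) (fun a => hK _) (fun a => hν _)
    have hle : (2 : ℝ) ^ s * b ≤ 2 ^ (s + 1) * b := by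
      have : (0 : ℝ) ≤ 2 ^ s * b := by positivity
      rw [pow_succ]; linarith
    obtain ⟨S, hS0, hS1, h01⟩ : ∃ S : Set V,
        (∀ (i : ℕ) (j : ℤ), ∑ a ∈ Finset.range (2 ^ s),
          U (2 * a) (j - (2 * e : ℕ) * i * a) ∈ S) ∧
        (∀ (i : ℕ) (j : ℤ), ∑ a ∈ Finset.range (2 ^ s),
          U (2 * a + 1) (j - (2 * e : ℕ) * i * a) ∈ S) ∧
        Reach ν (2 ^ (s + 1) * b) K (s * 2 ^ (s + 1) * r + s * 2 ^ (s + 1) * r) S :=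
      ⟨_, fun i j => Or.inl ⟨i, j, rfl⟩, fun i j => Or.inr ⟨i, j, rfl⟩,
        (h0.union h1).mono le_rfl hle (subset_signed _)⟩
    set Y : ℕ → ℤ → V := fun i j => ∑ a ∈ Finset.range (2 ^ (s + 1)), U a (j - e * i * a) with hY
    have hsplit : ∀ (i : ℕ) (j : ℤ), Y i j =
        ∑ a ∈ Finset.range (2 ^ s), U (2 * a) (j - (2 * e : ℕ) * i * a) +
        ∑ a ∈ Finset.range (2 ^ s), U (2 * a + 1) (j - e * i - (2 * e : ℕ) * i * a) := by
      intro i j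
      simp only [hY]
      rw [pow_succ', sum_range_two_mul]
      congr 1 <;> refine Finset.sum_congr rfl fun a _ => congrArg _ ?_ <;> push_cast <;> ring
    have hYb : ∀ i j, ν (Y i j) ≤ 2 ^ (s + 1) * b := fun i j => by
      have := seminorm_sum_le ν (n := 2 ^ (s + 1)) (f := fun a => U a (j - e * i * a))
        fun a _ => hν _ _
      simpa using this
    have hYanti : ∀ i j, Y i (j + r) = -Y i j := fun i j => by
      simp only [hY, ← Finset.sum_neg_distrib]
      refine Finset.sum_congr rfl fun a _ => ?_
      rw [← hU]; congr 1; ring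
    have hYper : ∀ (i t : ℕ) (j : ℤ), Y (i + t * 2 ^ (s + 2)) j = Y i j := fun i t j => by
      simp only [hY]
      refine Finset.sum_congr rfl fun a _ => ?_
      rw [← antiperiodic_two_mul (hU a) (-(t * a : ℤ)) (j - e * i * a)]
      congr 1
      rw [← he]; push_cast; ring
    -- The entries are periodic in `i` with period `2 ^ (s + 2)`, and antiperiodic in `j` with shift
    -- `r`; up to sign only `2 ^ (s + 2) * r` of them have to be computed.
    have h2 := Reach.iUnion (ν := ν) (B := 2 ^ (s + 1) * b) (K := S) (n := 2 ^ (s + 2)) (c := r * 1)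
      (A := fun i => {v | ∃ j < r, v ∈ ({Y i (j : ℤ)} : Set V)})
      fun i _ => Reach.iUnion (n := r) (c := 1) (A := fun j => {Y i (j : ℤ)})
        fun j _ => by
          have := hsplit i j
          have hB := hYb i j
          rw [this] at hB ⊢
          exact Reach.add (subset_signed _ (hS0 _ _)) (subset_signed _ (hS1 _ _)) hB
    refine (h01.trans h2).mono ?_ le_rfl ?_
    · apply le_of_eq; ring
    · rintro v ⟨i, j, rfl⟩
      change Y i j ∈ _
      have hmem : ∀ j' : ℕ, j' < r → Y i j' ∈ signed ({v | ∃ i < 2 ^ (s + 2),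
          v ∈ {v | ∃ j < r, v ∈ ({Y i (j : ℤ)} : Set V)}}) := fun j' hj' => by
        refine subset_signed _ ⟨i % 2 ^ (s + 2), Nat.mod_lt _ (by positivity), j', hj', ?_⟩
        have := hYper (i % 2 ^ (s + 2)) (i / 2 ^ (s + 2)) j'
        rw [Nat.mod_add_div'] at this
        exact this
      have hr' : (r : ℤ) ≠ 0 := by exact_mod_cast hr.ne'
      have hj := Int.emod_nonneg j hr'
      have hj2 := Int.emod_lt_of_pos j (by exact_mod_cast hr : (0 : ℤ) < r)
      obtain ⟨j', hj'⟩ := Int.eq_ofNat_of_zero_le hj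
      have h3 := hmem j' (by omega)
      have h4 := antiperiodic_mul (hYanti i) (j / r) (j % r)
      rw [Int.emod_add_ediv_mul, hj'] at h4
      refine signed_mono Set.subset_union_right ?_
      rcases h4 with h4 | h4 <;> rw [h4]
      · exact h3
      · exact neg_mem_signed h3

/-! ### Multiplication of antiperiodic sequences -/

/-- The rank-one bilinear form `v ⊗ v`, evaluated on pairs of additive functionals. -/
def tensorSq (v : V) : (V →+ ℂ) × (V →+ ℂ) → ℂ := fun φ => φ.1 v * φ.2 v

/-- The tensor square of the value at `ζ` of the polynomial with coefficients
`u 0, …, u (n - 1)`. -/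
def evalSq (n : ℕ) (u : ℤ → V) (ζ : ℂ) : (V →+ ℂ) × (V →+ ℂ) → ℂ := fun φ =>
  (∑ j ∈ Finset.range n, φ.1 (u j) * ζ ^ j) * (∑ j ∈ Finset.range n, φ.2 (u j) * ζ ^ j)

/-- This insensitivity to sign is why chains only need to reach vectors up to sign. -/
theorem tensorSq_neg (v : V) : tensorSq (-v) = tensorSq v := by
  funext φ; simp [tensorSq]

theorem exists_interpolation {n : ℕ} {x : ℕ → ℂ} (hx : Set.InjOn x (Finset.range n)) (z : ℂ) :
    ∃ c : ℕ → ℂ, ∀ p : Polynomial ℂ, p.degree < n →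
      p.eval z = ∑ i ∈ Finset.range n, c i * p.eval (x i) := by
  refine ⟨fun i => (Lagrange.basis (Finset.range n) x i).eval z, fun p hp => ?_⟩
  have := Lagrange.eq_interpolate (f := p) hx (by simpa using hp)
  conv_lhs => rw [this]
  rw [Lagrange.interpolate_apply, Polynomial.eval_finsetSum]
  refine Finset.sum_congr rfl fun i _ => ?_
  rw [Polynomial.eval_mul, Polynomial.eval_C, mul_comm]

/-- The product has degree less than `2 * n`, so its value at `z` is a combination of its values at
`2 * n` nodes. The coefficients depend on the nodes and on `z` but not on the two polynomials, which
makes the identity one between bilinear forms. -/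
theorem exists_interpolation_mul {n : ℕ} {x : ℕ → ℂ} (hx : Set.InjOn x (Finset.range (2 * n)))
    (z : ℂ) : ∃ c : ℕ → ℂ, ∀ f g : ℕ → ℂ,
      (∑ a ∈ Finset.range n, f a * z ^ a) * (∑ a ∈ Finset.range n, g a * z ^ a) =
      ∑ i ∈ Finset.range (2 * n), c i * ((∑ a ∈ Finset.range n, f a * x i ^ a) *
        (∑ a ∈ Finset.range n, g a * x i ^ a)) := by
  obtain ⟨c, hc⟩ := exists_interpolation hx z
  refine ⟨c, fun f g => ?_⟩
  have hdeg : ∀ f : ℕ → ℂ, (∑ a ∈ Finset.range n,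
      Polynomial.C (f a) * Polynomial.X ^ a).natDegree ≤ n - 1 := fun f =>
    Polynomial.natDegree_sum_le_of_forall_le _ _ fun a ha =>
      (Polynomial.natDegree_C_mul_X_pow_le _ _).trans (by have := Finset.mem_range.1 ha; omega)
  rcases Nat.eq_zero_or_pos n with rfl | hn
  · simp
  have := hc ((∑ a ∈ Finset.range n, Polynomial.C (f a) * Polynomial.X ^ a) *
    (∑ a ∈ Finset.range n, Polynomial.C (g a) * Polynomial.X ^ a)) ?_
  · simpa [Polynomial.eval_finsetSum] using this
  · refine Polynomial.degree_le_natDegree.trans_lt (Nat.cast_lt.2 ?_)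
    have h1 := hdeg f
    have h2 := hdeg g
    refine (Polynomial.natDegree_mul_le_of_le h1 h2).trans_lt (by omega)

/-- A coefficient pushed past position `r` returns with the opposite sign, and `η ^ r = -1` accounts
for exactly that sign. -/
theorem sum_shift {f : ℤ → ℂ} {r : ℕ} {η : ℂ} (hf : ∀ j, f (j + r) = -f j) (hη : η ^ r = -1)
    (e : ℕ) : ∑ j ∈ Finset.range r, f (j - e) * η ^ j
      = η ^ e * ∑ j ∈ Finset.range r, f j * η ^ j := by
  induction e with
  | zero => simp
  | succ e ih =>
    rw [pow_succ', mul_assoc, ← ih, Finset.mul_sum]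
    have h1 := Finset.sum_range_succ (fun j : ℕ => f ((j : ℤ) - (e + 1 : ℕ)) * η ^ j) r
    have h2 := Finset.sum_range_succ' (fun j : ℕ => f ((j : ℤ) - (e + 1 : ℕ)) * η ^ j) r
    rw [h1] at h2
    have h3 : f ((r : ℤ) - (e + 1 : ℕ)) * η ^ r = f (((0 : ℕ) : ℤ) - (e + 1 : ℕ)) * η ^ 0 := by
      rw [hη, show (r : ℤ) - (e + 1 : ℕ) = ((0 : ℕ) : ℤ) - (e + 1 : ℕ) + r by push_cast; ring, hf]
      ring
    rw [h3] at h2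
    rw [add_right_cancel h2]
    refine Finset.sum_congr rfl fun j _ => ?_
    rw [show ((j + 1 : ℕ) : ℤ) - (e + 1 : ℕ) = j - e by push_cast; ring]
    ring

theorem sum_range_mul {M : Type*} [AddCommMonoid M] (f : ℕ → M) (m r : ℕ) :
    ∑ i ∈ Finset.range (m * r), f i
      = ∑ a ∈ Finset.range m, ∑ j ∈ Finset.range r, f (a + m * j) := by
  rw [Finset.sum_comm]
  induction r with
  | zero => simp
  | succ r ih =>
    rw [Nat.mul_succ, Finset.sum_range_add, ih, Finset.sum_range_succ]
    congr 1
    exact Finset.sum_congr rfl fun a _ => by rw [add_comm]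

/-- Grouping indices by their residue modulo `2 ^ s` turns the value at `ζ` into a polynomial of
degree less than `2 ^ s` in `ζ`, with coefficients that are values at `η = ζ ^ 2 ^ s`. Its square is
interpolated from the nodes `(η ^ e) ^ i`. At such a node, multiplication by a power of `η` is a
shift, so the value there is again a value at `η` of an antiperiodic sequence, namely an output of
`reach_fft`. -/
theorem evalSq_mem_span (s r e : ℕ) (he : e * 2 ^ s = r) (u : ℤ → V)
    (hu : ∀ j, u (j + (2 ^ s * r : ℕ)) = -u j) {ζ : ℂ} (hζ : ζ ^ (2 ^ s * r) = -1) :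
    evalSq (2 ^ s * r) u ζ ∈ Submodule.span ℂ ((fun i : ℕ =>
      evalSq r (fun j => ∑ a ∈ Finset.range (2 ^ s), u (a + 2 ^ s * (j - e * i * a)))
        (ζ ^ 2 ^ s)) '' Set.Iio (2 * 2 ^ s)) := by
  set η := ζ ^ 2 ^ s with hη
  have hηr : η ^ r = -1 := by rw [hη, ← pow_mul, hζ]
  -- The power `2 ^ s` of `η ^ e` is `η ^ r = -1`, which makes the order exactly `2 ^ (s + 1)` and
  -- the nodes distinct.
  have hord : orderOf (η ^ e) = 2 ^ (s + 1) := by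
    apply orderOf_eq_prime_pow
    · rw [← pow_mul, he, hηr]; norm_num
    · rw [← pow_mul, pow_succ, ← mul_assoc, he, pow_mul, hηr]; norm_num
  have hinj : Set.InjOn (fun i => (η ^ e) ^ i) (Finset.range (2 * 2 ^ s)) := by
    have := pow_injOn_Iio_orderOf (x := η ^ e)
    rw [hord, pow_succ'] at this
    intro a ha b hb h
    exact this (by simpa using ha) (by simpa using hb) h
  obtain ⟨c, hc⟩ := exists_interpolation_mul hinj ζ
  have heval : ∀ φ : V →+ ℂ, ∑ j ∈ Finset.range (2 ^ s * r), φ (u j) * ζ ^ j =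
      ∑ a ∈ Finset.range (2 ^ s),
        (∑ j ∈ Finset.range r, φ (u (a + 2 ^ s * j)) * η ^ j) * ζ ^ a := fun φ => by
    rw [sum_range_mul]
    refine Finset.sum_congr rfl fun a _ => ?_
    rw [Finset.sum_mul]
    refine Finset.sum_congr rfl fun j _ => ?_
    rw [hη, ← pow_mul, pow_add]; push_cast; ring
  have heval' : ∀ (φ : V →+ ℂ) (i : ℕ), ∑ j ∈ Finset.range r,
      φ (∑ a ∈ Finset.range (2 ^ s), u (a + 2 ^ s * ((j : ℤ) - e * i * a))) * η ^ j =
      ∑ a ∈ Finset.range (2 ^ s),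
        (∑ j ∈ Finset.range r, φ (u (a + 2 ^ s * j)) * η ^ j) * ((η ^ e) ^ i) ^ a := fun φ i => by
    simp only [map_sum, Finset.sum_mul]
    rw [Finset.sum_comm]
    refine Finset.sum_congr rfl fun a _ => ?_
    rw [← Finset.sum_mul]
    have := sum_shift (f := fun j : ℤ => φ (u (a + 2 ^ s * j))) (r := r) (η := η) (fun j => by
      rw [show (a : ℤ) + 2 ^ s * (j + r) = a + 2 ^ s * j + (2 ^ s * r : ℕ) by push_cast; ring,
        hu, map_neg]) hηr (e * i * a)
    push_cast at this
    rw [this, mul_comm]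
    congr 1
    ring
  have : evalSq (2 ^ s * r) u ζ = ∑ i ∈ Finset.range (2 * 2 ^ s), c i •
      evalSq r (fun j => ∑ a ∈ Finset.range (2 ^ s), u (a + 2 ^ s * (j - e * i * a))) η := by
    funext φ
    simp only [evalSq, heval, Finset.sum_apply, Pi.smul_apply, smul_eq_mul, heval']
    exact hc _ _
  rw [this]
  exact Submodule.sum_mem _ fun i hi => Submodule.smul_mem _ _
    (Submodule.subset_span ⟨i, Finset.mem_range.1 hi, rfl⟩)

/-- Recursion of Schönhage–Strassen type: one transform reduces length `2 ^ k` to `2 ^ (s + 1)`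
problems of length `2 ^ (k - s)`, with `s` about `k / 2`. The set `K'` does not depend on `ζ`, so
one chain serves all roots of `-1`. -/
theorem exists_reach_evalSq (k : ℕ) : ∀ (u : ℤ → V) (b : ℝ) (K : Set V), 0 ≤ b →
    (∀ j, u (j + (2 ^ k : ℕ)) = -u j) → (∀ j, u j ∈ signed K) → (∀ j, ν (u j) ≤ b) →
    ∃ K' : Set V, Reach ν (2 ^ k * b) K (2 ^ (k + 1) * k ^ 2) K' ∧
      ∀ ζ : ℂ, ζ ^ 2 ^ k = -1 →
        evalSq (2 ^ k) u ζ ∈ Submodule.span ℂ (tensorSq '' K') := by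
  induction k using Nat.strong_induction_on with
  | _ k ih =>
  intro u b K hb hu hK hν
  rcases Nat.lt_or_ge k 2 with hk | hk
  · interval_cases k
    · refine ⟨{u 0}, (Reach.of_subset (by simpa using hK 0)).mono le_rfl le_rfl
        (subset_signed _), fun ζ _ => Submodule.subset_span ⟨u 0, rfl, ?_⟩⟩
      funext φ
      simp [tensorSq, evalSq]
    · refine ⟨{u 0, u 1} ∪ {u 0 + u 1}, ((Reach.of_subset ?_).union
        (Reach.add (hK 0) (hK 1) ?_)).mono (by norm_num) le_rfl (subset_signed _),
        fun ζ _ => ?_⟩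
      · rintro x (rfl | rfl)
        · exact hK 0
        · exact hK 1
      · refine (map_add_le_add ν _ _).trans ?_
        linarith [hν 0, hν 1]
      -- Karatsuba's identity: the mixed terms come from the square of `u 0 + u 1`.
      · have : evalSq (2 ^ 1) u ζ = (1 - ζ) • tensorSq (u 0) + (ζ ^ 2 - ζ) • tensorSq (u 1)
            + ζ • tensorSq (u 0 + u 1) := by
          funext φ
          simp [tensorSq, evalSq, Finset.sum_range_succ]
          ring
        rw [this]
        refine Submodule.add_mem _ (Submodule.add_mem _ ?_ ?_) ?_ <;>
          refine Submodule.smul_mem _ _ (Submodule.subset_span ⟨_, ?_, rfl⟩) <;> simp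
  -- Here `e'` is the parity of `k`, so that `r = 2 ^ (k - s)` is `2 ^ e' * 2 ^ s` as the transform
  -- requires. The last inequality closes the cost recursion after the common factor `2 ^ (k + 1)`
  -- is removed.
  · obtain ⟨s, e', hs, hs1, hsk, hcost⟩ : ∃ s e', e' + 2 * s = k ∧ 1 ≤ s ∧ e' ≤ 1 ∧
        s + 2 * (k - s) ^ 2 ≤ k ^ 2 := by
      refine ⟨k / 2, k % 2, by omega, by omega, by omega, ?_⟩
      rcases Nat.even_or_odd' k with ⟨t, rfl | rfl⟩
      · rw [show 2 * t / 2 = t by omega, show 2 * t - t = t by omega]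
        nlinarith
      · rw [show (2 * t + 1) / 2 = t by omega, show 2 * t + 1 - t = t + 1 by omega]
        have : 1 ≤ t := by omega
        nlinarith
    have hsub : k - s = e' + s := by omega
    have hkr : 2 ^ k = 2 ^ s * 2 ^ (k - s) := by rw [← pow_add]; congr 1; omega
    have her : 2 ^ e' * 2 ^ s = 2 ^ (k - s) := by rw [← pow_add, hsub]
    have hU : ∀ (a : ℕ) (j : ℤ), u (a + 2 ^ s * (j + (2 ^ (k - s) : ℕ))) =
        -u (a + 2 ^ s * j) := fun a j => by
      rw [← hu, hkr]
      congr 1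
      push_cast
      ring
    obtain ⟨S, hS, hKS⟩ : ∃ S : Set V, (∀ (i : ℕ) (j : ℤ), ∑ a ∈ Finset.range (2 ^ s),
          u (a + 2 ^ s * (j - (2 ^ e' : ℕ) * i * a)) ∈ S) ∧
        Reach ν (2 ^ s * b) K (s * 2 ^ (s + 1) * 2 ^ (k - s)) S :=
      ⟨{v | ∃ (i : ℕ) (j : ℤ), v = ∑ a ∈ Finset.range (2 ^ s),
          u (a + 2 ^ s * (j - (2 ^ e' : ℕ) * i * a))}, fun i j => ⟨i, j, rfl⟩, reach_fft (ν := ν) s (2 ^ e') (2 ^ (k - s)) her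
        (fun a j => u (a + 2 ^ s * j)) b K (by positivity) hb hU (fun a j => hK _)
        (fun a j => hν _)⟩
    have hY := fun i : ℕ => ih (k - s) (by omega)
      (fun j => ∑ a ∈ Finset.range (2 ^ s), u (a + 2 ^ s * (j - (2 ^ e' : ℕ) * i * a)))
      (2 ^ s * b) S (by positivity) (fun j => by
        rw [← Finset.sum_neg_distrib]
        refine Finset.sum_congr rfl fun a _ => ?_
        rw [← hU]
        congr 1
        ring) (fun j => subset_signed _ (hS i j)) (fun j => by
        have := seminorm_sum_le ν (n := 2 ^ s)
          (f := fun a => u (a + 2 ^ s * (j - (2 ^ e' : ℕ) * i * a))) fun a _ => hν _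
        simpa using this)
    choose K' hK' hspan using hY
    have hle : (2 : ℝ) ^ s * b ≤ 2 ^ k * b :=
      mul_le_mul_of_nonneg_right (pow_le_pow_right₀ one_le_two (by omega)) hb
    have hiter := Reach.iUnion (n := 2 * 2 ^ s) (A := K') fun i _ => hK' i
    have hB : (2 : ℝ) ^ (k - s) * (2 ^ s * b) = 2 ^ k * b := by
      rw [← mul_assoc, ← pow_add]
      congr 2
      omega
    rw [hB] at hiter
    refine ⟨_, ((hKS.mono le_rfl hle (subset_signed _)).trans hiter).mono ?_ le_rfl
      (subset_signed _), fun ζ hζ => ?_⟩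
    · calc s * 2 ^ (s + 1) * 2 ^ (k - s) + 2 * 2 ^ s * (2 ^ (k - s + 1) * (k - s) ^ 2)
          = 2 * (2 ^ s * 2 ^ (k - s)) * (s + 2 * (k - s) ^ 2) := by ring
        _ ≤ 2 * (2 ^ s * 2 ^ (k - s)) * k ^ 2 := Nat.mul_le_mul_left _ hcost
        _ = 2 ^ (k + 1) * k ^ 2 := by rw [← hkr]; ring
    · rw [hkr] at hu hζ ⊢
      refine Submodule.span_le.2 ?_ (evalSq_mem_span s _ _ her u hu hζ)
      rintro _ ⟨i, hi, rfl⟩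
      refine Submodule.span_mono (Set.image_mono ?_) (hspan i _ ?_)
      · exact fun v hv => Or.inr ⟨i, hi, hv⟩
      · rw [← pow_mul, hζ]

end Chains

/-! ### Products of binary numbers as combinations of products of short linear forms -/

/-- The sum of the absolute values of the entries of an integer vector. -/
def l1Seminorm (n : ℕ) : AddGroupSeminorm (Fin n → ℤ) where
  toFun v := ∑ i, |(v i : ℝ)|
  map_zero' := by simp
  add_le' v w := by
    rw [← Finset.sum_add_distrib]
    refine Finset.sum_le_sum fun i _ => ?_
    push_cast [Pi.add_apply]
    exact abs_add_le _ _
  neg' v := by simp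

/-- The unit vectors and zero. -/
def units (n : ℕ) : Finset (Fin n → ℤ) :=
  insert 0 (Finset.univ.image fun i => Pi.single i 1)

/-- The pairing of an integer vector with a vector over a commutative ring. -/
def pairing {n : ℕ} {A : Type} [CommRing A] (x : Fin n → A) : (Fin n → ℤ) →+ A where
  toFun v := ∑ i, (v i : A) * x i
  map_zero' := by simp
  map_add' v w := by simp [add_mul, Finset.sum_add_distrib]

/-- The product of two integers with `n` binary digits is a linear combination of products of
values of short integer linear forms, all of which are computed by a chain of quasi-linearly many
additions. -/
theorem exists_product_chain (n k : ℕ) (hk : 2 * n ≤ 2 ^ k) :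
    ∃ (l : List (Fin n → ℤ)) (w : (Fin n → ℤ) → ℝ),
      AddChain (units n : Set (Fin n → ℤ)) l ∧ l.length ≤ 2 ^ (k + 1) * k ^ 2 ∧
      (∀ v ∈ l, l1Seminorm n v ≤ 2 ^ k) ∧
      ∀ x y : Fin n → ℝ, (∑ i : Fin n, 2 ^ (i : ℕ) * x i) * (∑ i : Fin n, 2 ^ (i : ℕ) * y i) =
        ∑ v ∈ units n ∪ l.toFinset, w v * (pairing x v * pairing y v) := by
  set N := 2 ^ k with hN
  have hN0 : (N : ℤ) ≠ 0 := by positivity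
  -- The generic polynomial, whose coefficients are the unit vectors, is padded with zeros to length
  -- `N` and extended antiperiodically by the sign `(-1) ^ (j / N)`. The padding is why `units`
  -- contains zero.
  let base : ℤ → Fin n → ℤ := fun j => if h : j.toNat < n then Pi.single ⟨j.toNat, h⟩ 1 else 0
  let u : ℤ → Fin n → ℤ := fun j => ((j / N).negOnePow : ℤ) • base (j % N)
  have hbase : ∀ j, base j ∈ signed (units n : Set (Fin n → ℤ)) := fun j => by
    refine Or.inl ?_
    simp only [base]
    split_ifs <;> simp [units]
  have hsign : ∀ j, u j = base (j % N) ∨ u j = -base (j % N) := fun j => by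
    simp only [u]
    rcases Int.even_or_odd (j / N) with h | h
    · left; rw [Int.negOnePow_even _ h]; simp
    · right; rw [Int.negOnePow_odd _ h]; simp
  have hν : ∀ j, l1Seminorm n (u j) ≤ 1 := fun j => by
    have : l1Seminorm n (base (j % N)) ≤ 1 := by
      change ∑ i, |((base (j % N) i : ℤ) : ℝ)| ≤ 1
      simp only [base]
      split_ifs with h
      · rw [Finset.sum_eq_single ⟨(j % N).toNat, h⟩] <;> simp +contextual
      · simp
    rcases hsign j with h | h <;> rw [h]
    · exact this
    · rw [map_neg_eq_map]; exact this
  obtain ⟨K', ⟨l, hl, hlen, hbd, hK'⟩, hspan⟩ := exists_reach_evalSq (ν := l1Seminorm n) k u 1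
    (units n : Set (Fin n → ℤ)) zero_le_one (fun j => by
      simp only [u]
      rw [← hN, Int.add_ediv_of_dvd_right dvd_rfl, Int.ediv_self hN0, Int.add_emod_right,
        Int.negOnePow_succ]
      simp) (fun j => by
      rcases hsign j with h | h <;> rw [h]
      · exact hbase _
      · exact neg_mem_signed (hbase _)) hν
  have hu : ∀ (φ : (Fin n → ℤ) →+ ℂ) (ζ : ℂ), ∑ j ∈ Finset.range N, φ (u j) * ζ ^ j
      = ∑ i : Fin n, φ (Pi.single i 1) * ζ ^ (i : ℕ) := fun φ ζ => by
    have h1 : ∀ j ∈ Finset.range N, φ (u j) * ζ ^ j = φ (base j) * ζ ^ j := fun j hj => by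
      have hj : j < N := Finset.mem_range.1 hj
      have h1 : (j : ℤ) / N = 0 := Int.ediv_eq_zero_of_lt (by positivity) (by exact_mod_cast hj)
      have h2 : (j : ℤ) % N = j := Int.emod_eq_of_lt (by positivity) (by exact_mod_cast hj)
      simp [u, h1, h2]
    rw [Finset.sum_congr rfl h1, ← Finset.sum_range_add_sum_Ico _ (by omega : n ≤ N),
      Finset.sum_range, Finset.sum_eq_zero (s := Finset.Ico n N), add_zero]
    · refine Finset.sum_congr rfl fun i _ => ?_
      simp [base]
    · intro j hj
      have : ¬ j < n := not_lt.2 (Finset.mem_Ico.1 hj).1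
      simp [base, this]
  set E := units n ∪ l.toFinset with hE
  have hspan' : ∀ ζ : ℂ, ζ ^ N = -1 →
      evalSq N u ζ ∈ Submodule.span ℂ (tensorSq '' (E : Set (Fin n → ℤ))) := fun ζ hζ => by
    refine Submodule.span_le.2 ?_ (hspan ζ hζ)
    rintro _ ⟨v, hv, rfl⟩
    have hmem : ∀ v, v ∈ (units n : Set (Fin n → ℤ)) ∪ {x | x ∈ l} → v ∈ E := by
      rintro v (hv | hv)
      · exact Finset.mem_union_left _ hv
      · exact Finset.mem_union_right _ (List.mem_toFinset.2 hv)
    rcases hK' hv with h | h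
    · exact Submodule.subset_span ⟨v, hmem _ h, rfl⟩
    · exact Submodule.subset_span ⟨-v, hmem _ h, tensorSq_neg v⟩
  -- The roots of `z ^ N = -1` are the odd powers of a primitive root of unity of order `2 * N`.
  obtain ⟨ξ, hξ, hinj⟩ : ∃ ξ : ℕ → ℂ, (∀ i, ξ i ^ N = -1) ∧
      Set.InjOn ξ (Finset.range N) := by
    have hprim := Complex.isPrimitiveRoot_exp (2 ^ (k + 1)) (by positivity)
    set ω := Complex.exp (2 * Real.pi * Complex.I / (2 ^ (k + 1) : ℕ)) with hω
    have hωN : ω ^ N = -1 := by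
      have h1 : (ω ^ N - 1) * (ω ^ N + 1) = 0 := by
        have := hprim.pow_eq_one
        rw [pow_succ, pow_mul] at this
        linear_combination this
      rcases mul_eq_zero.1 h1 with h | h
      · exact absurd (sub_eq_zero.1 h) (hprim.pow_ne_one_of_pos_of_lt (by positivity)
          (by rw [hN]; exact pow_lt_pow_right₀ one_lt_two (by omega)))
      · exact eq_neg_of_add_eq_zero_left h
    refine ⟨fun i => ω ^ (2 * i + 1), fun i => ?_, fun i hi j hj h => ?_⟩
    · rw [← pow_mul, mul_comm, pow_mul, hωN, pow_succ, pow_mul]; simp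
    · have hi : i < N := Finset.mem_range.1 hi
      have hj : j < N := Finset.mem_range.1 hj
      have := hprim.pow_inj (by rw [pow_succ]; omega) (by rw [pow_succ]; omega) h
      omega
  -- The two integers are the values at `2` of the polynomials formed by their digits. Since `2 * n
  -- ≤ N`, there are enough roots of `-1` to interpolate the product without wrap-around.
  obtain ⟨c, hc⟩ := exists_interpolation_mul (n := n) (x := ξ)
    (hinj.mono (Finset.coe_subset.2 (Finset.range_mono hk))) 2
  have hmem : (∑ i ∈ Finset.range (2 * n), c i • evalSq N u (ξ i)) ∈
      Submodule.span ℂ (tensorSq '' (E : Set (Fin n → ℤ))) :=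
    Submodule.sum_mem _ fun i _ => Submodule.smul_mem _ _ (hspan' _ (hξ i))
  obtain ⟨w, hw⟩ := (Submodule.mem_span_image_finset_iff_exists_fun' ℂ).1 hmem
  -- The linear forms are real on real vectors, so passing to real parts affects only the weights.
  refine ⟨l, fun v => (w v).re, hl, hlen, by simpa using hbd, fun x y => ?_⟩
  have hpair : ∀ (x : Fin n → ℝ) (v : Fin n → ℤ),
      pairing (fun i => (x i : ℂ)) v = ((pairing x v : ℝ) : ℂ) := fun x v => by
    simp [pairing]
  have hsingle : ∀ (x : Fin n → ℂ) (i : Fin n), pairing x (Pi.single i 1) = x i := fun x i => by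
    change ∑ j, (((Pi.single i 1 : Fin n → ℤ) j : ℤ) : ℂ) * x j = x i
    rw [Finset.sum_eq_single i] <;> simp +contextual
  have h1 := congrFun hw (pairing fun i => (x i : ℂ), pairing fun i => (y i : ℂ))
  have h2 := hc (fun a => if h : a < n then (x ⟨a, h⟩ : ℂ) else 0)
    (fun a => if h : a < n then (y ⟨a, h⟩ : ℂ) else 0)
  simp only [Finset.sum_range, Fin.is_lt, dite_true, Fin.eta] at h2
  simp only [Finset.sum_apply, Pi.smul_apply, smul_eq_mul, evalSq, hu, hsingle,
    tensorSq] at h1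
  simp only [hpair] at h1
  rw [Finset.sum_range] at h1
  rw [← h2] at h1
  have h3 := congrArg Complex.re h1
  rw [Complex.re_sum] at h3
  have h4 : ((∑ i : Fin n, (x i : ℂ) * 2 ^ (i : ℕ)) * ∑ i : Fin n, (y i : ℂ) * 2 ^ (i : ℕ)) =
      (((∑ i : Fin n, 2 ^ (i : ℕ) * x i) * ∑ i : Fin n, 2 ^ (i : ℕ) * y i : ℝ) : ℂ) := by
    push_cast
    simp only [mul_comm]
  rw [h4, Complex.ofReal_re] at h3
  rw [← h3]
  refine Finset.sum_congr rfl fun v _ => ?_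
  rw [← Complex.ofReal_mul, Complex.re_mul_ofReal]

/-! ### Unitary operators acting on a part of a configuration -/

/-- `get` and `set` read and overwrite a component of a configuration. -/
structure IsLens {X κ : Type} (get : X → κ) (set : X → κ → X) : Prop where
  get_set : ∀ x c, get (set x c) = c
  set_set : ∀ x c c', set (set x c) c' = set x c'
  set_get : ∀ x, set x (get x) = x

section Lens

variable {X κ : Type} [Fintype κ] {get : X → κ} {set : X → κ → X}

/-- A matrix acting on a component of the configurations. -/
noncomputable def lensOp (get : X → κ) (set : X → κ → X) (U : Matrix κ κ ℂ)
    (ψ : EuclideanSpace ℂ X) : EuclideanSpace ℂ X :=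
  WithLp.toLp 2 fun x => ∑ c, U (get x) c * ψ (set x c)

theorem lensOp_lensOp (h : IsLens get set) (U W : Matrix κ κ ℂ) (ψ : EuclideanSpace ℂ X) :
    lensOp get set U (lensOp get set W ψ) = lensOp get set (U * W) ψ := by
  ext x
  simp only [lensOp, h.get_set, h.set_set, Matrix.mul_apply, Finset.mul_sum, Finset.sum_mul]
  rw [Finset.sum_comm]
  simp only [mul_assoc]

theorem lensOp_one [DecidableEq κ] (h : IsLens get set) (ψ : EuclideanSpace ℂ X) :
    lensOp get set 1 ψ = ψ := by
  ext x
  simp [lensOp, Matrix.one_apply, h.set_get]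

theorem inner_lensOp_left [Fintype X] (h : IsLens get set) (U : Matrix κ κ ℂ) (φ ψ : EuclideanSpace ℂ X) :
    inner ℂ (lensOp get set U φ) ψ = inner ℂ φ (lensOp get set Uᴴ ψ) := by
  simp only [PiLp.inner_apply, RCLike.inner_apply, lensOp, map_sum, map_mul, Finset.mul_sum,
    Finset.sum_mul]
  rw [← Fintype.sum_prod_type', ← Fintype.sum_prod_type']
  -- Exchanging the old and the new content of the component is an involution that turns one double
  -- sum into the other.
  have hinv : Function.Involutive fun p : X × κ => (set p.1 p.2, get p.1) := fun p => by
    simp [h.get_set, h.set_set, h.set_get]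
  refine Fintype.sum_equiv hinv.toPerm _ _ fun p => ?_
  simp [h.get_set, h.set_set, h.set_get, Matrix.conjTranspose_apply]
  ring

theorem norm_lensOp [Fintype X] [DecidableEq κ] (h : IsLens get set) (U : Matrix.unitaryGroup κ ℂ)
    (ψ : EuclideanSpace ℂ X) : ‖lensOp get set U.1 ψ‖ = ‖ψ‖ := by
  rw [← sq_eq_sq₀ (norm_nonneg _) (norm_nonneg _), ← @inner_self_eq_norm_sq ℂ,
    ← @inner_self_eq_norm_sq ℂ, inner_lensOp_left h, lensOp_lensOp h]
  have : (U.1)ᴴ * U.1 = 1 := Matrix.mem_unitaryGroup_iff'.1 U.2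
  rw [this, lensOp_one h]

end Lens

section Wires

variable {ι : Type} [DecidableEq ι]

theorem isLens_one (i : ι) :
    IsLens (fun x : ι → Bool => x i) (fun x c => Function.update x i c) :=
  ⟨by simp, by simp, by simp⟩

theorem isLens_two {i j : ι} (hij : i ≠ j) : IsLens (fun x : ι → Bool => (x i, x j))
    (fun x c => Function.update (Function.update x i c.1) j c.2) := by
  refine ⟨fun x c => ?_, fun x c c' => ?_, fun x => ?_⟩
  · simp [hij]
  · funext k
    by_cases hk : k = j
    · subst hk; simp
    · by_cases hk' : k = i
      · subst hk'; simp [hk]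
      · simp [hk, hk']
  · simp

end Wires

/-! ### Circuits -/

section Circuits

variable {d q m w : ℕ} {F : MeshIndex d q → BitVec m}

theorem bitVec_ofFnLE_injective : Function.Injective (BitVec.ofFnLE : (Fin m → Bool) → _) := by
  intro z z' h
  funext i
  have := congrArg (fun v => v.getLsb i) h
  simpa using this

/-- The permutation of the labels behind a query. -/
def queryMap (F : MeshIndex d q → BitVec m) (x : Qubit d q m w → Bool) : Qubit d q m w → Bool :=
  Sum.elim (fun r => x (.inl r))
    (Sum.elim (subBits (fun i => x (.inr (.inl i))) (F fun r => x (.inl r)))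
      (fun i => x (.inr (.inr i))))

theorem queryMap_bijective (F : MeshIndex d q → BitVec m) :
    Function.Bijective (queryMap (w := w) F) := by
  rw [← Finite.injective_iff_bijective]
  intro x y h
  have h1 : (fun r => x (.inl r)) = fun r => y (.inl r) :=
    funext fun r => congrFun h (.inl r)
  have h2 : (fun i => x (.inr (.inr i))) = fun i => y (.inr (.inr i)) :=
    funext fun i => congrFun h (.inr (.inr i))
  have h3 : BitVec.ofFnLE (fun i => x (.inr (.inl i))) - F (fun r => x (.inl r)) =
      BitVec.ofFnLE (fun i => y (.inr (.inl i))) - F (fun r => y (.inl r)) := by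
    refine BitVec.eq_of_getLsbD_eq fun i hi => ?_
    have := congrFun h (.inr (.inl ⟨i, hi⟩))
    rw [BitVec.getLsbD_eq_getElem hi, BitVec.getLsbD_eq_getElem hi]
    simpa [queryMap, subBits] using this
  rw [h1] at h3
  have h4 := bitVec_ofFnLE_injective (sub_left_injective h3)
  funext k
  rcases k with r | i | i
  · exact congrFun h1 r
  · exact congrFun h4 i
  · exact congrFun h2 i

theorem Gate.norm_apply (g : Gate d q m w) (ψ : QState (Qubit d q m w)) :
    ‖g.apply F ψ‖ = ‖ψ‖ := by
  cases g with
  | one i U => exact norm_lensOp (isLens_one i) U ψ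
  | two i j hij U => exact norm_lensOp (isLens_two hij) U ψ
  | query =>
    rw [EuclideanSpace.norm_eq, EuclideanSpace.norm_eq]
    congr 1
    exact (Equiv.ofBijective _ (queryMap_bijective F)).sum_comp fun x => ‖ψ x‖ ^ 2

theorem Gate.apply_add (g : Gate d q m w) (ψ ψ' : QState (Qubit d q m w)) :
    g.apply F (ψ + ψ') = g.apply F ψ + g.apply F ψ' := by
  cases g <;> ext x <;> simp [Gate.apply, mul_add, Finset.sum_add_distrib]

theorem Gate.apply_smul (g : Gate d q m w) (a : ℂ) (ψ : QState (Qubit d q m w)) :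
    g.apply F (a • ψ) = a • g.apply F ψ := by
  cases g <;> ext x <;> simp [Gate.apply, Finset.mul_sum, mul_left_comm]
  ring

theorem run_append (c c' : Circuit d q m w) (ψ : QState (Qubit d q m w)) :
    run F (c ++ c') ψ = run F c' (run F c ψ) := List.foldl_append

theorem run_cons (g : Gate d q m w) (c : Circuit d q m w) (ψ : QState (Qubit d q m w)) :
    run F (g :: c) ψ = run F c (g.apply F ψ) := rfl

theorem norm_run (c : Circuit d q m w) (ψ : QState (Qubit d q m w)) : ‖run F c ψ‖ = ‖ψ‖ := by
  induction c generalizing ψ with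
  | nil => rfl
  | cons g c ih => rw [run_cons, ih, Gate.norm_apply]

/-- A circuit as a linear map. -/
noncomputable def runLinear (F : MeshIndex d q → BitVec m) (c : Circuit d q m w) :
    QState (Qubit d q m w) →ₗ[ℂ] QState (Qubit d q m w) where
  toFun := run F c
  map_add' ψ ψ' := by
    induction c generalizing ψ ψ' with
    | nil => rfl
    | cons g c ih => simp only [run_cons, Gate.apply_add, ih]
  map_smul' a ψ := by
    induction c generalizing ψ with
    | nil => rfl
    | cons g c ih => simp only [run_cons, Gate.apply_smul, ih, RingHom.id_apply]

theorem run_smul (c : Circuit d q m w) (a : ℂ) (ψ : QState (Qubit d q m w)) :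
    run F c (a • ψ) = a • run F c ψ := (runLinear F c).map_smul a ψ

theorem run_sub (c : Circuit d q m w) (ψ ψ' : QState (Qubit d q m w)) :
    run F c (ψ - ψ') = run F c ψ - run F c ψ' := (runLinear F c).map_sub ψ ψ'

theorem run_sum {α : Type} (s : Finset α) (c : Circuit d q m w)
    (f : α → QState (Qubit d q m w)) : run F c (∑ a ∈ s, f a) = ∑ a ∈ s, run F c (f a) :=
  map_sum (runLinear F c) f s

/-- The inverse of an elementary operation that is not a query. -/
def Gate.inv : Gate d q m w → Gate d q m w
  | .one i U => .one i U⁻¹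
  | .two i j h U => .two i j h U⁻¹
  | .query => .query

/-- The inverse of a circuit without queries. -/
def invCircuit (c : Circuit d q m w) : Circuit d q m w := (c.map Gate.inv).reverse

theorem Gate.inv_apply (g : Gate d q m w) (hg : g.isQuery = false)
    (ψ : QState (Qubit d q m w)) : g.inv.apply F (g.apply F ψ) = ψ := by
  cases g with
  | one i U =>
    refine (lensOp_lensOp (isLens_one i) U⁻¹.1 U.1 ψ).trans ?_
    rw [← Submonoid.coe_mul, inv_mul_cancel]
    exact lensOp_one (isLens_one i) ψ
  | two i j hij U =>
    refine (lensOp_lensOp (isLens_two hij) U⁻¹.1 U.1 ψ).trans ?_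
    rw [← Submonoid.coe_mul, inv_mul_cancel]
    exact lensOp_one (isLens_two hij) ψ
  | query => simp [Gate.isQuery] at hg

theorem queryCount_append (c c' : Circuit d q m w) :
    queryCount (c ++ c') = queryCount c + queryCount c' := List.countP_append

theorem queryCount_cons_eq_zero {g : Gate d q m w} {c : Circuit d q m w} :
    queryCount (g :: c) = 0 ↔ g.isQuery = false ∧ queryCount c = 0 := by
  simp [queryCount]

theorem run_invCircuit {c : Circuit d q m w} (hc : queryCount c = 0)
    (ψ : QState (Qubit d q m w)) : run F (invCircuit c) (run F c ψ) = ψ := by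
  induction c generalizing ψ with
  | nil => rfl
  | cons g c ih =>
    obtain ⟨hg, hc⟩ := queryCount_cons_eq_zero.1 hc
    have : invCircuit (g :: c) = invCircuit c ++ [g.inv] := by simp [invCircuit]
    rw [this, run_append, run_cons, run_cons, ih hc]
    exact g.inv_apply hg ψ

theorem length_invCircuit (c : Circuit d q m w) : (invCircuit c).length = c.length := by
  simp [invCircuit]

theorem queryCount_invCircuit (c : Circuit d q m w) :
    queryCount (invCircuit c) = queryCount c := by
  rw [queryCount, invCircuit, List.countP_reverse, List.countP_map, queryCount]
  congr 1
  funext g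
  cases g <;> rfl

end Circuits

/-! ### Basis states -/

/-- A computational basis state. -/
noncomputable def ket {ι : Type} [Fintype ι] [DecidableEq ι] (x : ι → Bool) : QState ι :=
  EuclideanSpace.single x 1

/-- A label of the coordinate registers, extended by zeros. -/
def zext {d q m w : ℕ} (x : MeshIndex d q) : Qubit d q m w → Bool :=
  Sum.elim x fun _ => false

section Kets

variable {d q m w : ℕ} {F : MeshIndex d q → BitVec m}

theorem sum_smul_ket {ι : Type} [Fintype ι] [DecidableEq ι] (ψ : QState ι) :
    ∑ x, ψ x • ket x = ψ := by
  ext y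
  simp [ket, Finset.sum_apply, Pi.single_apply]

theorem withZeros_eq_sum (ψ : QState (Fin d × Fin q)) :
    withZeros (m := m) (w := w) ψ = ∑ x, ψ x • ket (zext x) := by
  ext y
  simp only [withZeros, ket, WithLp.ofLp_sum, Finset.sum_apply, PiLp.smul_apply, smul_eq_mul,
    PiLp.single_apply]
  split_ifs with h
  · rw [Finset.sum_eq_single fun r => y (.inl r)]
    · have : y = zext fun r => y (.inl r) := by
        funext k
        rcases k with r | r
        · rfl
        · exact h r
      rw [if_pos this, mul_one]
    · intro x _ hx
      rw [if_neg, mul_zero]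
      rintro rfl
      exact hx rfl
    · simp
  · rw [Finset.sum_eq_zero]
    intro x _
    rw [if_neg, mul_zero]
    rintro rfl
    exact h fun r => rfl

theorem withZeros_ket (x : MeshIndex d q) :
    withZeros (m := m) (w := w) (ket x) = ket (zext x) := by
  rw [withZeros_eq_sum]
  simp [ket]

theorem norm_withZeros (ψ : QState (Fin d × Fin q)) :
    ‖withZeros (m := m) (w := w) ψ‖ = ‖ψ‖ := by
  have h : ∀ y : Fin m ⊕ Fin w → Bool, (∀ r, y r = false) ↔ y = fun _ => false := fun y =>
    funext_iff.symm
  rw [EuclideanSpace.norm_eq, EuclideanSpace.norm_eq]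
  congr 1
  rw [← (Equiv.sumArrowEquivProdArrow _ _ Bool).symm.sum_comp, Fintype.sum_prod_type]
  refine Finset.sum_congr rfl fun x _ => ?_
  rw [Finset.sum_eq_single fun _ => false]
  · simp [withZeros]
  · intro y _ hy
    have : ¬ ∀ r, y r = false := fun h' => hy ((h y).1 h')
    simp only [withZeros, Equiv.sumArrowEquivProdArrow_symm_apply_inr, this, if_false, norm_zero,
      ne_eq, OfNat.ofNat_ne_zero, not_false_eq_true, zero_pow]
  · simp

theorem withZeros_sub (ψ ψ' : QState (Fin d × Fin q)) :
    withZeros (m := m) (w := w) (ψ - ψ') = withZeros ψ - withZeros ψ' := by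
  simp only [withZeros_eq_sum, ← Finset.sum_sub_distrib, ← sub_smul]
  rfl

theorem run_withZeros (c : Circuit d q m w) (ψ : QState (Fin d × Fin q)) :
    run F c (withZeros ψ) = ∑ x, ψ x • run F c (ket (zext x)) := by
  rw [withZeros_eq_sum, run_sum]
  simp only [run_smul]

/-! ### Matrices implemented by circuits -/

variable {c c' : Circuit d q m w} {M M' : Matrix (MeshIndex d q) (MeshIndex d q) ℂ}

theorem act_act (ψ : QState (Fin d × Fin q)) : act M' (act M ψ) = act (M' * M) ψ := by
  simp [act, Matrix.mulVec_mulVec]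

theorem Implements.append (h : Implements c M) (h' : Implements c' M') :
    Implements (c ++ c') (M' * M) :=
  ⟨by rw [queryCount_append, h.1, h'.1], fun F ψ => by
    rw [run_append, h.2, h'.2, act_act]⟩

theorem Implements.nil : Implements ([] : Circuit d q m w) 1 :=
  ⟨rfl, fun F ψ => by simp [act, run]⟩

theorem Implements.norm_act (h : Implements c M) (ψ : QState (Fin d × Fin q)) :
    ‖act M ψ‖ = ‖ψ‖ := by
  rw [← norm_withZeros (m := m) (w := w), ← h.2 (fun _ => 0), norm_run, norm_withZeros]

/-- Circuits preserve the norm, hence the matrix is injective. In this way `qsft` is invertible and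
`Implements.inv` yields its inverse without computing a formula for it. -/
theorem Implements.isUnit (h : Implements c M) : IsUnit M := by
  rw [← Matrix.mulVec_injective_iff_isUnit]
  intro v v' hv
  have h1 : act M (WithLp.toLp 2 (v - v')) = 0 := by
    simp only [act, Matrix.mulVec_sub]
    rw [sub_eq_zero.2 hv]
    rfl
  have h2 := h.norm_act (WithLp.toLp 2 (v - v'))
  rw [h1, norm_zero, eq_comm, norm_eq_zero] at h2
  exact sub_eq_zero.1 ((WithLp.toLp_injective 2) h2)

theorem Implements.inv (h : Implements c M) : Implements (invCircuit c) M⁻¹ := by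
  refine ⟨by rw [queryCount_invCircuit, h.1], fun F ψ => ?_⟩
  have h1 : act M (act M⁻¹ ψ) = ψ := by
    rw [act_act, Matrix.mul_nonsing_inv _ ((Matrix.isUnit_iff_isUnit_det _).1 h.isUnit)]
    simp [act]
  conv_lhs => rw [← h1, ← h.2 F, run_invCircuit h.1]

theorem implements_diagonal (hc : queryCount c = 0) {g : MeshIndex d q → ℂ}
    (h : ∀ F x, run F c (ket (zext x)) = g x • ket (zext x)) :
    Implements c (Matrix.diagonal g) := by
  refine ⟨hc, fun F ψ => ?_⟩
  rw [run_withZeros, withZeros_eq_sum]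
  refine Finset.sum_congr rfl fun x _ => ?_
  rw [h, smul_smul]
  simp [act, Matrix.mulVec_diagonal, mul_comm]

end Kets

/-! ### Phases -/

section Phases

variable {d q m w : ℕ}

/-- The diagonal unitary matrix with the given phases. -/
noncomputable def diagUnitary {κ : Type} [Fintype κ] [DecidableEq κ] (g : κ → ℝ) :
    Matrix.unitaryGroup κ ℂ :=
  ⟨Matrix.diagonal fun c => Complex.exp (Complex.I * g c), by
    rw [Matrix.mem_unitaryGroup_iff, Matrix.star_eq_conjTranspose, Matrix.diagonal_conjTranspose,
      Matrix.diagonal_mul_diagonal, ← Matrix.diagonal_one]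
    congr 1
    funext c
    rw [Pi.star_apply, Complex.star_def, ← Complex.exp_conj, ← Complex.exp_add]
    simp⟩

/-- The circuit multiplies the basis state `|x⟩` by `exp (i g(x))`. -/
def IsPhase (c : Circuit d q m w) (g : (Qubit d q m w → Bool) → ℝ) : Prop :=
  queryCount c = 0 ∧ ∀ F x, run F c (ket x) = Complex.exp (Complex.I * g x) • ket x

theorem IsPhase.nil : IsPhase ([] : Circuit d q m w) fun _ => 0 :=
  ⟨rfl, fun F x => by simp [run]⟩

theorem IsPhase.append {c c' : Circuit d q m w} {g g' : (Qubit d q m w → Bool) → ℝ}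
    (h : IsPhase c g) (h' : IsPhase c' g') : IsPhase (c ++ c') fun x => g x + g' x :=
  ⟨by rw [queryCount_append, h.1, h'.1], fun F x => by
    rw [run_append, h.2, run_smul, h'.2, smul_smul, ← Complex.exp_add, Complex.ofReal_add,
      mul_add]⟩

theorem IsPhase.congr {c : Circuit d q m w} {g g' : (Qubit d q m w → Bool) → ℝ}
    (h : IsPhase c g) (hg : ∀ x, g x = g' x) : IsPhase c g' := by
  rwa [← funext hg]

theorem lensOp_diagonal_ket {ι κ : Type} [Fintype ι] [DecidableEq ι] [Fintype κ]
    [DecidableEq κ] {get : (ι → Bool) → κ} {set : (ι → Bool) → κ → ι → Bool}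
    (h : IsLens get set) (g : κ → ℝ) (x : ι → Bool) :
    lensOp get set (diagUnitary g).1 (ket x) =
      Complex.exp (Complex.I * g (get x)) • ket x := by
  ext y
  simp only [lensOp, diagUnitary, Matrix.diagonal_apply, ite_mul, zero_mul, Finset.sum_ite_eq,
    Finset.mem_univ, if_true, h.set_get, PiLp.smul_apply, smul_eq_mul]
  by_cases hy : y = x
  · rw [hy]
  · simp [ket, hy]

theorem exists_phase_one (i : Qubit d q m w) (g : Bool → ℝ) :
    ∃ c : Circuit d q m w, c.length = 1 ∧ IsPhase c fun x => g (x i) :=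
  ⟨[.one i (diagUnitary g)], rfl, rfl, fun _ x => lensOp_diagonal_ket (isLens_one i) g x⟩

theorem exists_phase_two (i j : Qubit d q m w) (g : Bool → Bool → ℝ) :
    ∃ c : Circuit d q m w, c.length = 1 ∧ IsPhase c fun x => g (x i) (x j) := by
  by_cases hij : i = j
  · subst hij
    exact exists_phase_one i fun b => g b b
  · exact ⟨[.two i j hij (diagUnitary fun b => g b.1 b.2)], rfl, rfl, fun _ x =>
      lensOp_diagonal_ket (isLens_two hij) (fun b => g b.1 b.2) x⟩

/-- The value of a linear form, given by wires and weights, on a label. -/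
def wireVal {ι : Type} (l : List (ι × ℝ)) (x : ι → Bool) : ℝ :=
  (l.map fun p => if x p.1 then p.2 else 0).sum

theorem exists_phase_linear (θ : ℝ) (l : List (Qubit d q m w × ℝ)) :
    ∃ c : Circuit d q m w, c.length = l.length ∧ IsPhase c fun x => θ * wireVal l x := by
  induction l with
  | nil => exact ⟨[], rfl, IsPhase.nil.congr fun _ => by simp [wireVal]⟩
  | cons p l ih =>
    obtain ⟨c, hc, h⟩ := ih
    obtain ⟨c', hc', h'⟩ := exists_phase_one p.1 fun b => θ * if b then p.2 else 0
    exact ⟨c' ++ c, by simp [hc, hc']; omega, (h'.append h).congr fun x => by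
      simp [wireVal, mul_add]⟩

theorem exists_phase_bilinear (θ : ℝ) (l l' : List (Qubit d q m w × ℝ)) :
    ∃ c : Circuit d q m w, c.length = l.length * l'.length ∧
      IsPhase c fun x => θ * (wireVal l x * wireVal l' x) := by
  have hone : ∀ (p : Qubit d q m w × ℝ) (l' : List (Qubit d q m w × ℝ)),
      ∃ c : Circuit d q m w, c.length = l'.length ∧
        IsPhase c fun x => θ * ((if x p.1 then p.2 else 0) * wireVal l' x) := by
    intro p l'
    induction l' with
    | nil => exact ⟨[], rfl, IsPhase.nil.congr fun _ => by simp [wireVal]⟩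
    | cons p' l ih =>
      obtain ⟨c, hc, h⟩ := ih
      obtain ⟨c', hc', h'⟩ := exists_phase_two p.1 p'.1 fun b b' =>
        θ * ((if b then p.2 else 0) * if b' then p'.2 else 0)
      exact ⟨c' ++ c, by simp [hc, hc']; omega, (h'.append h).congr fun x => by
        simp only [wireVal, List.map_cons, List.sum_cons]; ring⟩
  induction l with
  | nil => exact ⟨[], by simp, IsPhase.nil.congr fun _ => by simp [wireVal]⟩
  | cons p l ih =>
    obtain ⟨c, hc, h⟩ := ih
    obtain ⟨c', hc', h'⟩ := hone p l'
    exact ⟨c' ++ c, by simp [hc, hc']; ring, (h'.append h).congr fun x => by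
      simp only [wireVal, List.map_cons, List.sum_cons]; ring⟩

theorem IsPhase.implements {c : Circuit d q m w} {g : (Qubit d q m w → Bool) → ℝ}
    (h : IsPhase c g) :
    Implements c (Matrix.diagonal fun x => Complex.exp (Complex.I * g (zext x))) :=
  implements_diagonal h.1 fun F _ => h.2 F _

end Phases

/-! ### Matrices acting on a set of wires -/

section Blocks

variable {ι : Type} [Fintype ι] [DecidableEq ι]

/-- A matrix with kernel `f` that acts on the wires in `S` only. -/
def blockMat (S : Finset ι) (f : (ι → Bool) → (ι → Bool) → ℂ) :
    Matrix (ι → Bool) (ι → Bool) ℂ :=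
  Matrix.of fun x y => if ∀ i, i ∉ S → x i = y i then f x y else 0

theorem blockMat_congr {S : Finset ι} {f g : (ι → Bool) → (ι → Bool) → ℂ}
    (h : ∀ x y, f x y = g x y) : blockMat S f = blockMat S g := by
  congr 1
  funext x y
  exact h x y

/-- The intermediate label is forced: on `S` it agrees with the input `y`, off `S` with the output
`x`. Hence the sum in the matrix product has one term. -/
theorem blockMat_mul {S T : Finset ι} (hST : Disjoint S T)
    (f g : (ι → Bool) → (ι → Bool) → ℂ) : blockMat S f * blockMat T g =
      blockMat (S ∪ T) fun x y => f x (S.piecewise y x) * g (S.piecewise y x) y := by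
  ext x y
  rw [Matrix.mul_apply, Finset.sum_eq_single (S.piecewise y x)]
  · have h1 : ∀ i, i ∉ S → x i = S.piecewise y x i := fun i hi => by simp [hi]
    have h2 : (∀ i, i ∉ T → S.piecewise y x i = y i) ↔ ∀ i, i ∉ S ∪ T → x i = y i := by
      refine forall_congr' fun i => ?_
      by_cases hi : i ∈ S <;> simp [hi]
    simp only [blockMat, Matrix.of_apply, if_pos h1, h2, mul_ite, mul_zero]
  · intro z _ hz
    simp only [blockMat, Matrix.of_apply]
    split_ifs with h1 h2 <;> try simp
    refine absurd (funext fun i => ?_) hz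
    by_cases hi : i ∈ S
    · rw [Finset.piecewise_eq_of_mem _ _ _ hi]
      exact h2 i (Finset.disjoint_left.1 hST hi)
    · rw [Finset.piecewise_eq_of_notMem _ _ _ hi]
      exact (h1 i hi).symm
  · simp

theorem diagonal_mul_blockMat (g : (ι → Bool) → ℂ) (T : Finset ι)
    (f : (ι → Bool) → (ι → Bool) → ℂ) :
    Matrix.diagonal g * blockMat T f = blockMat T fun x y => g x * f x y := by
  ext x y
  simp [Matrix.diagonal_mul, blockMat]

theorem blockMat_singleton_mulVec (i : ι) (U : Matrix Bool Bool ℂ) (ψ : (ι → Bool) → ℂ)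
    (x : ι → Bool) : (blockMat {i} (fun x y => U (x i) (y i)) *ᵥ ψ) x =
      ∑ c, U (x i) c * ψ (Function.update x i c) := by
  have h : ∀ y, (blockMat {i} (fun x y => U (x i) (y i)) x y) * ψ y =
      ∑ c, if Function.update x i c = y then U (x i) c * ψ y else 0 := fun y => by
    have hc : ∀ c, Function.update x i c = y → c = y i := by
      rintro c rfl
      simp
    rw [Finset.sum_eq_single (y i)]
    · have : (∀ k, k ∉ ({i} : Finset ι) → x k = y k) ↔ Function.update x i (y i) = y := by
        rw [Function.update_eq_iff]
        simp
      simp only [blockMat, Matrix.of_apply, this, ite_mul, zero_mul]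
    · intro c _ hcy
      rw [if_neg fun h => hcy (hc c h)]
    · simp
  rw [Matrix.mulVec, dotProduct, Finset.sum_congr rfl fun y _ => h y, Finset.sum_comm]
  simp

/-- The number held by the wires `v`, least significant bit first. -/
def regVal {n : ℕ} (v : Fin n → ι) (x : ι → Bool) : ℕ :=
  ∑ i, if x (v i) then 2 ^ (i : ℕ) else 0

/-- The number held by the wires `v`, most significant bit first. -/
def regRev {n : ℕ} (v : Fin n → ι) (x : ι → Bool) : ℕ :=
  ∑ i, if x (v i) then 2 ^ (n - 1 - (i : ℕ)) else 0

/-- The quantum Fourier transform on the wires `v`, the bits of the output being reversed. -/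
noncomputable def fourierBlock {n : ℕ} (v : Fin n → ι) : Matrix (ι → Bool) (ι → Bool) ℂ :=
  blockMat (Finset.univ.image v) fun x y => ((Real.sqrt (2 ^ n) : ℝ) : ℂ)⁻¹ *
    Complex.exp (2 * Real.pi * Complex.I * (regVal v y * regRev v x) / 2 ^ n)

theorem exp_two_pi_add_nat (a : ℂ) (k : ℕ) :
    Complex.exp (a + 2 * Real.pi * Complex.I * k) = Complex.exp a := by
  rw [Complex.exp_add, mul_comm _ (k : ℂ), Complex.exp_nat_mul_two_pi_mul_I, mul_one]

/-- Expand `(lo y + 2 ^ h * hi y) * (2 ^ g * lo x + hi x) / 2 ^ (h + g)`. Two terms are the smaller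
transforms, one is the twiddle factor, and the last is an integer. When the twiddle acts, the high
wires already hold output bits and the low wires still hold input bits. Reversing the output bits
makes the high and low parts stay in place. -/
theorem fourierBlock_add {h g : ℕ} (v : Fin (h + g) → ι) (hv : Function.Injective v) :
    fourierBlock v = fourierBlock (fun i => v (Fin.castAdd g i)) *
      (Matrix.diagonal (fun z => Complex.exp (Complex.I * ((2 * Real.pi / 2 ^ (h + g) *
        (regVal (fun i => v (Fin.castAdd g i)) z * regRev (fun i => v (Fin.natAdd h i)) z) :
          ℝ)))) *
      fourierBlock (fun i => v (Fin.natAdd h i))) := by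
  set lo := fun i => v (Fin.castAdd g i) with hlo
  set hi := fun i => v (Fin.natAdd h i) with hhi
  have hdisj : Disjoint (Finset.univ.image lo) (Finset.univ.image hi) := by
    rw [Finset.disjoint_left]
    intro k hk hk'
    obtain ⟨i, -, rfl⟩ := Finset.mem_image.1 hk
    obtain ⟨j, -, hj⟩ := Finset.mem_image.1 hk'
    have := congrArg Fin.val (hv hj)
    simp at this
    omega
  have hunion : Finset.univ.image lo ∪ Finset.univ.image hi = Finset.univ.image v := by
    ext k
    simp only [Finset.mem_union, Finset.mem_image, Finset.mem_univ, true_and]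
    constructor
    · rintro (⟨i, rfl⟩ | ⟨i, rfl⟩)
      · exact ⟨_, rfl⟩
      · exact ⟨_, rfl⟩
    · rintro ⟨i, rfl⟩
      induction i using Fin.addCases with
      | left i => exact Or.inl ⟨i, rfl⟩
      | right i => exact Or.inr ⟨i, rfl⟩
  simp only [fourierBlock]
  rw [diagonal_mul_blockMat, blockMat_mul hdisj, hunion]
  refine blockMat_congr fun x y => ?_
  set z := (Finset.univ.image lo).piecewise y x with hz
  have hzlo : ∀ i, z (lo i) = y (lo i) := fun i => by
    rw [hz, Finset.piecewise_eq_of_mem]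
    exact Finset.mem_image_of_mem _ (Finset.mem_univ i)
  have hzhi : ∀ i, z (hi i) = x (hi i) := fun i => by
    rw [hz, Finset.piecewise_eq_of_notMem]
    exact fun h' => Finset.disjoint_left.1 hdisj h'
      (Finset.mem_image_of_mem _ (Finset.mem_univ i))
  have e1 : regVal lo z = regVal lo y := by simp only [regVal, hzlo]
  have e2 : regRev hi z = regRev hi x := by simp only [regRev, hzhi]
  have e3 : regVal v y = regVal lo y + 2 ^ h * regVal hi y := by
    simp only [regVal, Fin.sum_univ_add, Finset.mul_sum]
    congr 1
    refine Finset.sum_congr rfl fun i _ => ?_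
    simp [hhi, pow_add]
  have e4 : regRev v x = 2 ^ g * regRev lo x + regRev hi x := by
    simp only [regRev, Fin.sum_univ_add, Finset.mul_sum]
    congr 1
    · refine Finset.sum_congr rfl fun i _ => ?_
      have : h + g - 1 - (Fin.castAdd g i : ℕ) = g + (h - 1 - i) := by
        simp; omega
      rw [this]
      simp [hlo, pow_add]
    · refine Finset.sum_congr rfl fun i _ => ?_
      have : h + g - 1 - (Fin.natAdd h i : ℕ) = g - 1 - i := by
        simp; omega
      rw [this]
  rw [e1, e2, e3, e4]
  have hsq : ((Real.sqrt (2 ^ (h + g)) : ℝ) : ℂ)⁻¹ =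
      ((Real.sqrt (2 ^ h) : ℝ) : ℂ)⁻¹ * ((Real.sqrt (2 ^ g) : ℝ) : ℂ)⁻¹ := by
    rw [pow_add, Real.sqrt_mul (by positivity)]
    push_cast
    rw [mul_inv]
  have h2 : (2 : ℂ) ^ h ≠ 0 := pow_ne_zero _ two_ne_zero
  have h3 : (2 : ℂ) ^ g ≠ 0 := pow_ne_zero _ two_ne_zero
  -- The integer term `hi y * lo x` is inserted as a full number of turns.
  rw [hsq, ← exp_two_pi_add_nat (_ * _ / 2 ^ h) (regVal hi y * regRev lo x)]
  have hexp : ∀ (r s a b c : ℂ), r * Complex.exp a * (Complex.exp b * (s * Complex.exp c)) =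
      r * s * Complex.exp (a + b + c) := fun r s a b c => by
    rw [Complex.exp_add, Complex.exp_add]; ring
  rw [hexp]
  congr 2
  push_cast
  rw [pow_add]
  field_simp
  ring

end Blocks

/-- A cost function on matrices for which the Fourier transform on `n` wires has quasi-linear cost
as soon as the twiddle factors have. -/
theorem fourierBlock_cost {ι : Type} [Fintype ι] [DecidableEq ι]
    (P : ℕ → Matrix (ι → Bool) (ι → Bool) ℂ → Prop)
    (hmono : ∀ a b M, a ≤ b → P a M → P b M)
    (hmul : ∀ a b M N, P a M → P b N → P (a + b) (N * M))
    (hone : ∀ v : Fin 1 → ι, P 1 (fourierBlock v)) {X B : ℕ}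
    (hdiag : ∀ (h g : ℕ) (lo : Fin h → ι) (hi : Fin g → ι) (θ : ℝ), 1 ≤ h → 1 ≤ g → h + g ≤ B →
      P ((h + g) * X)
        (Matrix.diagonal fun z => Complex.exp (Complex.I * ((θ * (regVal lo z * regRev hi z) : ℝ)))))
    (D : ℕ) : ∀ (n : ℕ) (v : Fin n → ι), Function.Injective v → 1 ≤ n → n ≤ 2 ^ D → n ≤ B →
      P (n * (D * X + 1)) (fourierBlock v) := by
  induction D with
  | zero =>
    intro n v _ hn hn' _
    obtain rfl : n = 1 := by omega
    exact hmono _ _ _ (by omega) (hone v)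
  | succ D ih =>
    intro n v hv hn hn' hB
    rcases Nat.lt_or_ge n 2 with h2 | h2
    · obtain rfl : n = 1 := by omega
      exact hmono _ _ _ (by omega) (hone v)
    -- Both halves pay `D * X + 1` per wire and the twiddle adds `X` per wire, which gives `(D + 1)
    -- * X + 1`.
    · obtain ⟨h, g, rfl, hh, hg, hh', hg'⟩ : ∃ h g, n = h + g ∧ 1 ≤ h ∧ 1 ≤ g ∧ h ≤ 2 ^ D ∧
          g ≤ 2 ^ D := ⟨n / 2, n - n / 2, by omega, by omega, by omega, by omega, by omega⟩
      rw [fourierBlock_add v hv]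
      refine hmono _ _ _ ?_ (hmul _ _ _ _ (hmul _ _ _ _
        (ih g _ (hv.comp (Fin.natAdd_injective g h)) hg hg' (by omega))
        (hdiag h g _ _ _ hh hg hB))
        (ih h _ (hv.comp (Fin.castAdd_injective h g)) hh hh' (by omega)))
      apply le_of_eq
      ring

/-! ### The Hadamard gate -/

/-- The Hadamard gate. -/
noncomputable def hadamard : Matrix.unitaryGroup Bool ℂ :=
  ⟨Matrix.of fun a b => ((Real.sqrt 2 : ℝ) : ℂ)⁻¹ * if a && b then -1 else 1, by
    have h : ((Real.sqrt 2 : ℝ) : ℂ)⁻¹ * ((Real.sqrt 2 : ℝ) : ℂ)⁻¹ = 1 / 2 := by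
      rw [← mul_inv, ← Complex.ofReal_mul, Real.mul_self_sqrt (by norm_num)]
      norm_num
    rw [Matrix.mem_unitaryGroup_iff]
    ext a b
    cases a <;> cases b <;>
      norm_num [Matrix.mul_apply, Matrix.star_apply, h]⟩

theorem fourierBlock_one {ι : Type} [Fintype ι] [DecidableEq ι] (v : Fin 1 → ι) :
    fourierBlock v = blockMat {v 0} fun x y => hadamard.1 (x (v 0)) (y (v 0)) := by
  have : Finset.univ.image v = {v 0} := by
    ext k; simp
  rw [fourierBlock, this]
  refine blockMat_congr fun x y => ?_
  cases hx : x (v 0) <;> cases hy : y (v 0) <;>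
    simp only [hadamard, regVal, regRev, Fin.sum_univ_one, hx, hy] <;> simp
  rw [show 2 * (Real.pi : ℂ) * Complex.I / 2 = Real.pi * Complex.I by ring,
    Complex.exp_pi_mul_I, mul_neg_one]

/-! ### Gates and Fourier transforms on arbitrary qubits -/

section Realize

variable {d q m w : ℕ}

/-- The circuit `c`, which makes no query, acts as the matrix `M` on all qubits. -/
def Realizes (c : Circuit d q m w) (M : Matrix (Qubit d q m w → Bool) (Qubit d q m w → Bool) ℂ) :
    Prop :=
  queryCount c = 0 ∧ ∀ F ψ, run F c ψ = WithLp.toLp 2 (M *ᵥ ψ.ofLp)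

theorem Realizes.append {c c' : Circuit d q m w}
    {M M' : Matrix (Qubit d q m w → Bool) (Qubit d q m w → Bool) ℂ} (h : Realizes c M)
    (h' : Realizes c' M') : Realizes (c ++ c') (M' * M) :=
  ⟨by rw [queryCount_append, h.1, h'.1], fun F ψ => by
    rw [run_append, h.2, h'.2, Matrix.mulVec_mulVec]⟩

theorem realizes_one (i : Qubit d q m w) (U : Matrix.unitaryGroup Bool ℂ) :
    Realizes [.one i U] (blockMat {i} fun x y => U.1 (x i) (y i)) :=
  ⟨rfl, fun F ψ => by
    ext x
    exact (blockMat_singleton_mulVec i U.1 ψ.ofLp x).symm⟩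

theorem implements_one (r : Fin d × Fin q) (U : Matrix.unitaryGroup Bool ℂ) :
    Implements ([.one (.inl r) U] : Circuit d q m w)
      (blockMat {r} fun x y => U.1 (x r) (y r)) :=
  ⟨rfl, fun F ψ => by
    ext x
    change ∑ c, U.1 (x (.inl r)) c * withZeros ψ (Function.update x (.inl r) c) = _
    simp only [withZeros, act, blockMat_singleton_mulVec]
    have h1 : ∀ c, (fun k : Fin d × Fin q => Function.update x (.inl r) c (.inl k)) =
        Function.update (fun k => x (.inl k)) r c := fun c => by
      funext k
      by_cases hk : k = r
      · subst hk; simp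
      · simp [hk]
    simp only [h1, ne_eq, reduceCtorEq, not_false_eq_true, Function.update_of_ne]
    split_ifs <;> simp⟩

theorem IsPhase.run_eq {c : Circuit d q m w} {g : (Qubit d q m w → Bool) → ℝ}
    (h : IsPhase c g) (F : MeshIndex d q → BitVec m) (ψ : QState (Qubit d q m w)) :
    run F c ψ = WithLp.toLp 2 fun x => Complex.exp (Complex.I * g x) * ψ x := by
  conv_lhs => rw [← sum_smul_ket ψ]
  rw [run_sum]
  ext y
  simp only [run_smul, h.2]
  simp only [WithLp.ofLp_sum, Finset.sum_apply, PiLp.smul_apply, smul_eq_mul, ket,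
    PiLp.single_apply]
  rw [Finset.sum_eq_single y]
  · simp [mul_comm]
  · intro x _ hx
    simp [Ne.symm hx]
  · simp

theorem IsPhase.realizes {c : Circuit d q m w} {g : (Qubit d q m w → Bool) → ℝ}
    (h : IsPhase c g) :
    Realizes c (Matrix.diagonal fun x => Complex.exp (Complex.I * g x)) :=
  ⟨h.1, fun F ψ => by
    rw [h.run_eq]
    ext x
    simp [Matrix.mulVec_diagonal]⟩

theorem run_realizes_ket {c : Circuit d q m w}
    {M : Matrix (Qubit d q m w → Bool) (Qubit d q m w → Bool) ℂ} (h : Realizes c M)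
    (F : MeshIndex d q → BitVec m) (x y : Qubit d q m w → Bool) :
    run F c (ket x) y = M y x := by
  rw [h.2]
  simp [ket]

/-- The linear form whose value is the number held by the wires `v`. -/
def regList {ι : Type} {n : ℕ} (v : Fin n → ι) (wt : Fin n → ℝ) : List (ι × ℝ) :=
  List.ofFn fun i => (v i, wt i)

theorem length_regList {ι : Type} {n : ℕ} (v : Fin n → ι) (wt : Fin n → ℝ) :
    (regList v wt).length = n := by simp [regList]

theorem wireVal_regList {ι : Type} {n : ℕ} (v : Fin n → ι) (wt : Fin n → ℝ) (x : ι → Bool) :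
    wireVal (regList v wt) x = ∑ i, if x (v i) then wt i else 0 := by
  simp [wireVal, regList, List.map_ofFn, List.sum_ofFn]

theorem wireVal_regList_val {ι : Type} {n : ℕ} (v : Fin n → ι) (x : ι → Bool) :
    wireVal (regList v fun i => 2 ^ (i : ℕ)) x = regVal v x := by
  simp [wireVal_regList, regVal]

theorem wireVal_regList_rev {ι : Type} {n : ℕ} (v : Fin n → ι) (x : ι → Bool) :
    wireVal (regList v fun i => 2 ^ (n - 1 - (i : ℕ))) x = regRev v x := by
  simp [wireVal_regList, regRev]

/-- The schoolbook version, with one two-qubit phase per pair of bits in each twiddle. Its cubic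
bound suffices because the adders apply it only to registers of logarithmic length. -/
theorem exists_realizes_fourierBlock {n : ℕ} (hn : 1 ≤ n) (v : Fin n → Qubit d q m w)
    (hv : Function.Injective v) :
    ∃ c : Circuit d q m w, c.length ≤ n * (n * n + 1) ∧ Realizes c (fourierBlock v) := by
  refine fourierBlock_cost (fun a M => ∃ c : Circuit d q m w, c.length ≤ a ∧ Realizes c M)
    ?_ ?_ ?_ (X := n) (B := n) ?_ n n v hv hn Nat.lt_two_pow_self.le le_rfl
  · rintro a b M hab ⟨c, hc, h⟩
    exact ⟨c, hc.trans hab, h⟩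
  · rintro a b M N ⟨c, hc, h⟩ ⟨c', hc', h'⟩
    exact ⟨c ++ c', by simp; omega, h.append h'⟩
  · intro v
    rw [fourierBlock_one]
    exact ⟨_, le_rfl, realizes_one _ _⟩
  · intro h g lo hi θ _ _ hB
    obtain ⟨c, hc, h⟩ := exists_phase_bilinear θ (regList lo fun i => 2 ^ (i : ℕ))
      (regList hi fun i => 2 ^ (g - 1 - (i : ℕ)))
    refine ⟨c, ?_, ?_⟩
    · rw [hc, length_regList, length_regList]
      nlinarith
    · simpa only [wireVal_regList_val, wireVal_regList_rev] using h.realizes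

end Realize

/-! ### Two's complement -/

/-- The weight of a bit in two's complement. -/
noncomputable def intWeight (n : ℕ) (i : Fin n) : ℝ :=
  if (i : ℕ) + 1 = n then -2 ^ (i : ℕ) else 2 ^ (i : ℕ)

theorem ofBits_eq_sum {n : ℕ} (z : Fin n → Bool) :
    Nat.ofBits z = ∑ i, if z i then 2 ^ (i : ℕ) else 0 := by
  induction n with
  | zero => simp
  | succ n ih =>
    rw [Nat.ofBits_succ, ih, Fin.sum_univ_succ, Finset.mul_sum, add_comm]
    congr 1
    · cases z 0 <;> simp
    · refine Finset.sum_congr rfl fun i _ => ?_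
      simp [pow_succ']

theorem toInt_ofFnLE_eq_sum {n : ℕ} (z : Fin n → Bool) :
    ((BitVec.ofFnLE z).toInt : ℝ) = ∑ i, if z i then intWeight n i else 0 := by
  rw [BitVec.toInt_ofFnLE, Int.ofBits]
  cases n with
  | zero => simp
  | succ n =>
    have h1 : Nat.ofBits z = Nat.ofBits (fun i : Fin n => z i.castSucc) +
        if z (Fin.last n) then 2 ^ n else 0 := by
      rw [ofBits_eq_sum, ofBits_eq_sum, Fin.sum_univ_castSucc]
      simp
    have h2 := Nat.ofBits_lt_two_pow fun i : Fin n => z i.castSucc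
    have h3 : ((Nat.ofBits fun i : Fin n => z i.castSucc : ℕ) : ℝ) =
        ∑ i : Fin n, if z i.castSucc then intWeight (n + 1) i.castSucc else 0 := by
      rw [ofBits_eq_sum]
      push_cast
      refine Finset.sum_congr rfl fun i _ => ?_
      have : (i : ℕ) ≠ n := i.2.ne
      simp [intWeight, this]
    rw [Fin.sum_univ_castSucc, ← h3, h1, pow_succ, Int.subNatNat_eq_coe]
    cases z (Fin.last n)
    · rw [if_pos (by simp; omega)]
      simp
    · rw [if_neg (by simp; omega)]
      simp [intWeight]
      ring

theorem ofFnLE_getLsb {n : ℕ} (v : BitVec n) : BitVec.ofFnLE (fun i => v.getLsb i) = v := by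
  refine BitVec.eq_of_getLsbD_eq fun i hi => ?_
  rw [BitVec.getLsbD_eq_getElem hi, BitVec.getLsbD_eq_getElem hi]
  simp

/-! ### Addition into a fresh register -/

section Adder

variable {d q m w : ℕ}

/-- The coordinate wires and the work wires before position `s`. -/
def Below (s : ℕ) : Qubit d q m w → Prop
  | .inl _ => True
  | .inr (.inl _) => False
  | .inr (.inr i) => (i : ℕ) < s

theorem Below.mono {s t : ℕ} (hst : s ≤ t) {k : Qubit d q m w} (h : Below s k) : Below t k := by
  rcases k with r | i | i
  · trivial
  · exact h
  · exact lt_of_lt_of_le h hst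

/-- The `L` work wires from position `s` on. -/
def workReg (d q m : ℕ) {w s L : ℕ} (h : s + L ≤ w) : Fin L → Qubit d q m w :=
  fun i => .inr (.inr ⟨s + i, by omega⟩)

theorem workReg_injective {s L : ℕ} (h : s + L ≤ w) :
    Function.Injective (workReg d q m h) := fun i j hij => by
  simp only [workReg, Sum.inr.injEq, Fin.mk.injEq] at hij
  ext
  omega

theorem wireVal_congr {ι : Type} {l : List (ι × ℝ)} {x y : ι → Bool}
    (h : ∀ p ∈ l, x p.1 = y p.1) : wireVal l x = wireVal l y := by
  unfold wireVal
  congr 1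
  refine List.map_congr_left fun p hp => ?_
  rw [h p hp]

theorem wireVal_append {ι : Type} (l l' : List (ι × ℝ)) (x : ι → Bool) :
    wireVal (l ++ l') x = wireVal l x + wireVal l' x := by
  simp [wireVal]

/-- Addition in Fourier space: transform a zero register, multiply by phases bilinear in the
register and in the summands, and transform back. No carries are needed, the summands may have
arbitrary real weights as long as the total is an integer, and negative totals come out in two's
complement. Work qubits beyond the new register stay zero, ready for the next addition. -/
theorem exists_adder {s L : ℕ} (hL : 1 ≤ L) (h : s + L ≤ w) (e : MeshIndex d q → Qubit d q m w → Bool)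
    (hzero : ∀ x (i : Fin w), s ≤ i → e x (.inr (.inr i)) = false)
    {l l' : List (Qubit d q m w × ℝ)} (hl : ∀ p ∈ l, Below s p.1) (hl' : ∀ p ∈ l', Below s p.1)
    (hlen : l.length ≤ L) (hlen' : l'.length ≤ L) (z : MeshIndex d q → ℤ)
    (hz : ∀ x, wireVal l (e x) + wireVal l' (e x) = z x) (hbd : ∀ x, |z x| < 2 ^ (L - 1)) :
    ∃ (c : Circuit d q m w) (e' : MeshIndex d q → Qubit d q m w → Bool),
      queryCount c = 0 ∧ c.length ≤ 6 * L ^ 3 ∧ (∀ F x, run F c (ket (e x)) = ket (e' x)) ∧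
      (∀ x k, Below s k → e' x k = e x k) ∧
      (∀ x (i : Fin w), s + L ≤ i → e' x (.inr (.inr i)) = false) ∧
      ∀ x, wireVal (regList (workReg d q m h) (intWeight L)) (e' x) = z x := by
  set v := workReg d q m h with hv
  obtain ⟨cF, hcF, hF⟩ := exists_realizes_fourierBlock hL v (workReg_injective h)
  obtain ⟨cD, hcD, hD⟩ := exists_phase_bilinear (2 * Real.pi / 2 ^ L)
    (regList v fun i => 2 ^ (L - 1 - (i : ℕ))) (l ++ l')
  have hbelow : ∀ k : Qubit d q m w, Below s k → k ∉ Finset.univ.image v := by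
    rintro k hk hk'
    obtain ⟨i, -, rfl⟩ := Finset.mem_image.1 hk'
    simp only [hv, workReg, Below] at hk
    omega
  let bits : MeshIndex d q → ℕ → Bool := fun x i => (BitVec.ofInt L (z x)).getLsbD i
  let e' : MeshIndex d q → Qubit d q m w → Bool := fun x => Sum.elim (fun r => e x (.inl r))
    (Sum.elim (fun i => e x (.inr (.inl i)))
      (fun i => if (i : ℕ) < s then e x (.inr (.inr i)) else bits x (i - s)))
  have he'v : ∀ x i, e' x (v i) = (BitVec.ofInt L (z x)).getLsb i := fun x i => by
    simp [e', hv, workReg, bits]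
  have he'off : ∀ x k, k ∉ Finset.univ.image v → e' x k = e x k := by
    rintro x (r | i | i) hk
    · rfl
    · rfl
    · simp only [e', Sum.elim_inr]
      split_ifs with hi
      · rfl
      · have hi2 : s + L ≤ i := by
          by_contra hcon
          refine hk (Finset.mem_image.2 ⟨⟨i - s, by omega⟩, Finset.mem_univ _, ?_⟩)
          simp only [hv, workReg, Sum.inr.injEq, Fin.ext_iff]
          omega
        rw [hzero x i (by omega)]
        exact BitVec.getLsbD_of_ge _ _ (by omega)
  have hev : ∀ x i, e x (v i) = false := fun x i => hzero x _ (by simp)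
  refine ⟨cF ++ cD ++ invCircuit cF, e', ?_, ?_, fun F x => ?_, fun x k hk => ?_, fun x i hi => ?_,
    fun x => ?_⟩
  · simp [queryCount_append, queryCount_invCircuit, hF.1, hD.1]
  · rw [length_regList, List.length_append] at hcD
    rw [List.length_append, List.length_append, length_invCircuit, hcD]
    have : L * (l.length + l'.length) ≤ L * (L + L) := Nat.mul_le_mul_left _ (by omega)
    have h2 : L ≤ L * L := Nat.le_mul_of_pos_left _ hL
    have h3 : L * L ≤ L * L * L := Nat.le_mul_of_pos_right _ hL
    calc _ ≤ L * (L * L + 1) + L * (L + L) + L * (L * L + 1) := by omega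
      _ = 2 * (L * L * L) + 2 * (L * L) + 2 * L := by ring
      _ ≤ 6 * (L * L * L) := by omega
      _ = 6 * L ^ 3 := by ring
  -- It suffices that the phases carry the transform of `e x` to the transform of `e' x`; the
  -- inverse circuit then returns `e' x` itself.
  · have key : run F cD (run F cF (ket (e x))) = run F cF (ket (e' x)) := by
      rw [hD.run_eq]
      ext y
      rw [run_realizes_ket hF]
      change _ * run F cF (ket (e x)) y = _
      rw [run_realizes_ket hF]
      have hiff : (∀ i, i ∉ Finset.univ.image v → y i = e x i) ↔
          ∀ i, i ∉ Finset.univ.image v → y i = e' x i :=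
        forall_congr' fun i => forall_congr' fun hi => by rw [he'off x i hi]
      simp only [fourierBlock, blockMat, Matrix.of_apply, hiff]
      split_ifs with hy
      · have h0 : regVal v (e x) = 0 := by simp [regVal, hev]
        have h1 : wireVal (l ++ l') y = z x := by
          rw [← hz, ← wireVal_append]
          refine wireVal_congr fun p hp => hiff.2 hy _ (hbelow _ ?_)
          rcases List.mem_append.1 hp with hp | hp
          · exact hl p hp
          · exact hl' p hp
        -- The register holds `z x` only modulo `2 ^ L`; the discrepancy contributes whole turns to
        -- the phase.
        obtain ⟨t, ht⟩ : ∃ t : ℤ, z x = (regVal v (e' x) : ℤ) + 2 ^ L * t := by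
          have h2 : regVal v (e' x) = (BitVec.ofInt L (z x)).toNat := by
            rw [← ofFnLE_getLsb (BitVec.ofInt L (z x)), BitVec.toNat_ofFnLE, ofBits_eq_sum]
            simp only [regVal, he'v]
          refine ⟨z x / 2 ^ L, ?_⟩
          rw [h2, BitVec.toNat_ofInt, Int.toNat_of_nonneg (Int.emod_nonneg _ (by positivity))]
          push_cast
          exact (Int.emod_add_mul_ediv _ _).symm
        rw [h0, h1, wireVal_regList_rev, ht]
        have h3 : ∀ (r a b c : ℂ) (k : ℤ), a = c + k * (2 * Real.pi * Complex.I) → b = 0 →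
            Complex.exp a * (r * Complex.exp b) = r * Complex.exp c := by
          rintro r a b c k rfl rfl
          rw [Complex.exp_add, Complex.exp_int_mul_two_pi_mul_I, Complex.exp_zero]
          ring
        refine h3 _ _ _ _ (t * regRev v y) ?_ (by simp)
        have h2 : (2 : ℂ) ^ L ≠ 0 := pow_ne_zero _ two_ne_zero
        push_cast
        field_simp
      · simp
    rw [run_append, run_append, key, run_invCircuit hF.1]
  · exact he'off x k (hbelow k hk)
  · simp only [e', Sum.elim_inr]
    rw [if_neg (by omega)]
    exact BitVec.getLsbD_of_ge _ _ (by omega)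
  · rw [wireVal_regList]
    have h2 := toInt_ofFnLE_eq_sum fun i => (BitVec.ofInt L (z x)).getLsb i
    rw [ofFnLE_getLsb] at h2
    simp only [he'v]
    have h3 : (2 : ℤ) ^ L = 2 ^ (L - 1) * 2 := by rw [← pow_succ, Nat.sub_add_cancel hL]
    have h4 := abs_lt.1 (hbd x)
    rw [← h2, BitVec.toInt_ofInt, Int.bmod_eq_of_le_mul_two] <;> push_cast <;> rw [h3] <;> omega

/-- At stage `s` of a computation, in which the labels are `e`, there is a linear form in at most
`L` wires that has the values `f`. -/
def HasForm (s L : ℕ) (e : MeshIndex d q → Qubit d q m w → Bool) (f : MeshIndex d q → ℤ) : Prop :=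
  ∃ l : List (Qubit d q m w × ℝ), l.length ≤ L ∧ (∀ p ∈ l, Below s p.1) ∧
    ∀ x, wireVal l (e x) = f x

theorem wireVal_neg {ι : Type} (l : List (ι × ℝ)) (x : ι → Bool) :
    wireVal (l.map fun p => (p.1, -p.2)) x = -wireVal l x := by
  induction l with
  | nil => simp [wireVal]
  | cons p l ih =>
    simp only [wireVal, List.map_cons, List.sum_cons] at ih ⊢
    rw [ih, neg_add]
    split_ifs <;> simp

theorem HasForm.neg {s L : ℕ} {e : MeshIndex d q → Qubit d q m w → Bool}
    {f : MeshIndex d q → ℤ} (h : HasForm s L e f) : HasForm s L e fun x => -f x := by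
  obtain ⟨l, hl, hb, hv⟩ := h
  refine ⟨l.map fun p => (p.1, -p.2), by simpa using hl, ?_, fun x => ?_⟩
  · intro p hp
    obtain ⟨p', hp', rfl⟩ := List.mem_map.1 hp
    exact hb p' hp'
  · rw [Int.cast_neg, ← hv, wireVal_neg]

theorem HasForm.mono {s t L : ℕ} {e e' : MeshIndex d q → Qubit d q m w → Bool}
    {f : MeshIndex d q → ℤ} (h : HasForm s L e f) (hst : s ≤ t)
    (he : ∀ x k, Below s k → e' x k = e x k) : HasForm t L e' f := by
  obtain ⟨l, hl, hb, hv⟩ := h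
  refine ⟨l, hl, fun p hp => (hb p hp).mono hst, fun x => ?_⟩
  rw [← hv, wireVal_congr fun p hp => he x _ (hb p hp)]

/-- Each vector of the chain gets a fresh register of `L` qubits and one adder. Subtraction costs
nothing extra, since a form is negated by negating its weights. -/
theorem exists_chain_circuit {V : Type} [AddCommGroup V] {K : Set V} {l : List V}
    (hl : AddChain K l) (Φ : MeshIndex d q → V →+ ℤ) {s L : ℕ} (hL : 1 ≤ L)
    (e : MeshIndex d q → Qubit d q m w → Bool)
    (hzero : ∀ x (i : Fin w), s ≤ i → e x (.inr (.inr i)) = false)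
    (hK : ∀ v ∈ K, HasForm s L e fun x => Φ x v)
    (hbd : ∀ v ∈ l, ∀ x, |Φ x v| < 2 ^ (L - 1)) (hw : s + l.length * L ≤ w) :
    ∃ (c : Circuit d q m w) (e' : MeshIndex d q → Qubit d q m w → Bool),
      queryCount c = 0 ∧ c.length ≤ l.length * (6 * L ^ 3) ∧
      (∀ F x, run F c (ket (e x)) = ket (e' x)) ∧
      (∀ x k, Below s k → e' x k = e x k) ∧
      (∀ x (i : Fin w), s + l.length * L ≤ i → e' x (.inr (.inr i)) = false) ∧
      ∀ v ∈ K ∪ {x | x ∈ l}, HasForm (s + l.length * L) L e' fun x => Φ x v := by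
  induction hl with
  | nil => exact ⟨[], e, rfl, by simp, fun _ _ => rfl, fun _ _ _ => rfl, by simpa using hzero,
      by simpa using hK⟩
  | @cons l a b _ ha hb ih =>
    have hlen : s + (l.length + 1) * L = s + l.length * L + L := by ring
    simp only [List.length_cons, hlen] at hw ⊢
    obtain ⟨c, e₁, hq, hc, hrun, hbelow, hzero₁, hform⟩ :=
      ih (fun v hv => hbd v (List.mem_cons_of_mem _ hv)) (by omega)
    have hsigned : ∀ v ∈ signed (K ∪ {x | x ∈ l}),
        HasForm (s + l.length * L) L e₁ fun x => Φ x v := by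
      rintro v (hv | hv)
      · exact hform v hv
      · simpa using (hform _ hv).neg
    obtain ⟨la, hla, hba, hva⟩ := hsigned a ha
    obtain ⟨lb, hlb, hbb, hvb⟩ := hsigned b hb
    obtain ⟨c', e₂, hq', hc', hrun', hbelow', hzero₂, hval⟩ := exists_adder hL hw e₁ hzero₁
      hba hbb hla hlb (fun x => Φ x (a + b)) (fun x => by rw [hva, hvb, map_add]; push_cast; rfl)
      (hbd _ (by simp))
    refine ⟨c ++ c', e₂, ?_, ?_, fun F x => ?_, fun x k hk => ?_, hzero₂, ?_⟩
    · rw [queryCount_append, hq, hq']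
    · rw [List.length_append, Nat.succ_mul]
      omega
    · rw [run_append, hrun, hrun']
    · rw [hbelow' x k (hk.mono (by omega)), hbelow x k hk]
    · have hold : ∀ v ∈ K ∪ {x | x ∈ l}, HasForm (s + l.length * L + L) L e₂ fun x => Φ x v :=
        fun v hv => (hform v hv).mono (by omega) hbelow'
      rintro v (hv | hv)
      · exact hold v (Or.inl hv)
      · rcases List.mem_cons.1 hv with rfl | hv
        · refine ⟨_, (length_regList _ _).le, ?_, hval⟩
          intro p hp
          obtain ⟨i, rfl⟩ := (List.mem_ofFn' _ _).1 hp
          simp only [workReg, Below]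
          omega
        · exact hold v (Or.inr hv)

/-! ### The phase of a product -/

theorem exists_phase_sum {α : Type} (l : List α) {g : α → (Qubit d q m w → Bool) → ℝ} {n : ℕ}
    (h : ∀ a ∈ l, ∃ c : Circuit d q m w, c.length ≤ n ∧ IsPhase c (g a)) :
    ∃ c : Circuit d q m w, c.length ≤ l.length * n ∧
      IsPhase c fun x => (l.map fun a => g a x).sum := by
  induction l with
  | nil => exact ⟨[], by simp, IsPhase.nil.congr fun _ => by simp⟩
  | cons a l ih =>
    obtain ⟨c, hc, h'⟩ := ih fun a ha => h a (List.mem_cons_of_mem _ ha)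
    obtain ⟨c₀, hc₀, h₀⟩ := h a (by simp)
    exact ⟨c₀ ++ c, by simp only [List.length_append, List.length_cons, Nat.succ_mul]; omega,
      (h₀.append h').congr fun _ => by simp⟩

/-- The bits of a register as integers, missing wires standing for zeros. -/
def bitVal {n : ℕ} (v : Fin n → Option (Fin d × Fin q)) (x : MeshIndex d q) : Fin n → ℤ :=
  fun i => (v i).elim 0 fun r => if x r then 1 else 0

theorem bitVal_eq {n : ℕ} (v : Fin n → Option (Fin d × Fin q)) (x : MeshIndex d q) (i : Fin n) :
    bitVal v x i = 0 ∨ bitVal v x i = 1 := by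
  unfold bitVal
  cases v i with
  | none => simp
  | some r => cases x r <;> simp

theorem abs_pairing_le {n : ℕ} (v : Fin n → Option (Fin d × Fin q)) (x : MeshIndex d q) (u : Fin n → ℤ) :
    |(pairing (bitVal v x) u : ℝ)| ≤ l1Seminorm n u := by
  change |((∑ i, (u i : ℤ) * bitVal v x i : ℤ) : ℝ)| ≤ ∑ i, |(u i : ℝ)|
  push_cast
  refine (Finset.abs_sum_le_sum_abs _ _).trans (Finset.sum_le_sum fun i _ => ?_)
  rcases bitVal_eq v x i with h | h <;> simp [h]

theorem hasForm_units {n s L : ℕ} (hL : 1 ≤ L) (v : Fin n → Option (Fin d × Fin q))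
    {e : MeshIndex d q → Qubit d q m w → Bool} (he : ∀ x r, e x (.inl r) = x r) :
    ∀ u ∈ (units n : Set (Fin n → ℤ)), HasForm s L e fun x => pairing (bitVal v x) u := by
  intro u hu
  simp only [units, Finset.coe_insert, Finset.coe_image, Finset.coe_univ, Set.image_univ,
    Set.mem_insert_iff, Set.mem_range] at hu
  rcases hu with rfl | ⟨i, rfl⟩
  · exact ⟨[], by simp, by simp, by simp [wireVal]⟩
  · have : ∀ x, pairing (bitVal v x) (Pi.single i 1) = bitVal v x i := fun x => by
      change ∑ j, ((Pi.single i 1 : Fin n → ℤ) j : ℤ) * bitVal v x j = _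
      rw [Finset.sum_eq_single i] <;> simp +contextual
    simp only [this, bitVal]
    cases v i with
    | none => exact ⟨[], by simp, by simp, by simp [wireVal]⟩
    | some r =>
      exact ⟨[(.inl r, 1)], by simpa using hL, by simp [Below], fun x => by simp [wireVal, he]⟩

/-- The number of work qubits that suffice for the phase of a product. -/
def workSize (k : ℕ) : ℕ := 2 * (2 ^ (k + 1) * k ^ 2 * (k + 2))

/-- All values of the forms of `exists_product_chain` are computed for both factors, each form
contributes a phase bilinear in two short registers, and the forms are uncomputed. The state remains
a basis state until the phase is applied, so uncomputing restores the zeros exactly. -/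
theorem exists_phase_product {n k : ℕ} (hk : 2 * n ≤ 2 ^ k) (hw : workSize k ≤ w)
    (v v' : Fin n → Option (Fin d × Fin q)) (θ : ℝ) :
    ∃ c : Circuit d q m w, c.length ≤ 26 * 2 ^ (k + 1) * (k + 2) ^ 5 ∧
      Implements c (Matrix.diagonal fun x =>
        Complex.exp (Complex.I * ((θ * ((∑ i : Fin n, 2 ^ (i : ℕ) * (bitVal v x i : ℝ)) *
          ∑ i : Fin n, 2 ^ (i : ℕ) * (bitVal v' x i : ℝ)) : ℝ)))) := by
  obtain ⟨l, wt, hl, hlen, hbd, hprod⟩ := exists_product_chain n k hk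
  -- The forms are at most `2 ^ k` in absolute value, and two's complement with `L` bits holds
  -- everything below `2 ^ (L - 1) = 2 ^ (k + 1)`.
  set L := k + 2 with hL
  have hL1 : 1 ≤ L := by omega
  have hbd' : ∀ v : Fin n → Option (Fin d × Fin q), ∀ u ∈ l, ∀ x : MeshIndex d q,
      |pairing (bitVal v x) u| < 2 ^ (L - 1) := fun v u hu x => by
    have h1 := (abs_pairing_le v x u).trans (hbd u hu)
    have h2 : |pairing (bitVal v x) u| ≤ 2 ^ k := by exact_mod_cast h1
    refine h2.trans_lt ?_
    rw [hL]
    exact pow_lt_pow_right₀ one_lt_two (by omega)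
  have hlenL : l.length * L ≤ 2 ^ (k + 1) * k ^ 2 * L := Nat.mul_le_mul_right _ hlen
  have hw' : 2 * (2 ^ (k + 1) * k ^ 2 * L) ≤ w := hw
  obtain ⟨c₁, e₁, hq₁, hc₁, hrun₁, hbelow₁, hzero₁, hform₁⟩ := exists_chain_circuit (m := m)
    (w := w) hl (fun x => pairing (bitVal v x)) (s := 0) hL1 zext (fun _ _ _ => rfl)
    (hasForm_units hL1 v fun _ _ => rfl) (hbd' v) (by omega)
  obtain ⟨c₂, e₂, hq₂, hc₂, hrun₂, hbelow₂, hzero₂, hform₂⟩ := exists_chain_circuit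
    hl (fun x => pairing (bitVal v' x)) hL1 e₁ hzero₁
    (hasForm_units hL1 v' fun x r => hbelow₁ x (.inl r) trivial) (hbd' v') (by omega)
  obtain ⟨cD, hcD, hD⟩ : ∃ cD : Circuit d q m w,
      cD.length ≤ (units n ∪ l.toFinset).toList.length * (L * L) ∧ ∃ g, IsPhase cD g ∧
        ∀ x, g (e₂ x) = ((units n ∪ l.toFinset).toList.map fun u => θ * wt u *
          (pairing (bitVal v x) u * pairing (bitVal v' x) u : ℝ)).sum := by
    have hmem : ∀ u ∈ (units n ∪ l.toFinset).toList,
        u ∈ (units n : Set (Fin n → ℤ)) ∪ {x | x ∈ l} := fun u hu => by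
      rcases Finset.mem_union.1 (Finset.mem_toList.1 hu) with h | h
      · exact Or.inl h
      · exact Or.inr (List.mem_toFinset.1 h)
    -- The phase function must be chosen for every `u`; outside the list a dummy is taken.
    have hex : ∀ u, ∃ g : (Qubit d q m w → Bool) → ℝ,
        u ∈ (units n ∪ l.toFinset).toList →
        (∃ c : Circuit d q m w, c.length ≤ L * L ∧ IsPhase c g) ∧
        ∀ x, g (e₂ x) = θ * wt u * (pairing (bitVal v x) u * pairing (bitVal v' x) u : ℝ) := by
      intro u
      by_cases hu : u ∈ (units n ∪ l.toFinset).toList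
      · obtain ⟨la, hla, -, hva⟩ := (hform₁ u (hmem u hu)).mono le_rfl hbelow₂
        obtain ⟨lb, hlb, -, hvb⟩ := hform₂ u (hmem u hu)
        obtain ⟨c, hc, h⟩ := exists_phase_bilinear (θ * wt u) la lb
        exact ⟨_, fun _ => ⟨⟨c, hc.le.trans (Nat.mul_le_mul hla hlb), h⟩, fun x => by
          rw [hva, hvb]⟩⟩
      · exact ⟨fun _ => 0, fun h => absurd h hu⟩
    choose g hg using hex
    obtain ⟨c, hc, h⟩ := exists_phase_sum _ fun u hu => (hg u hu).1
    exact ⟨c, hc, _, h, fun x => congrArg List.sum (List.map_congr_left fun u hu =>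
      (hg u hu).2 x)⟩
  obtain ⟨g, hgD, hg⟩ := hD
  refine ⟨(c₁ ++ c₂) ++ cD ++ invCircuit (c₁ ++ c₂), ?_, ?_⟩
  · have hcard : (units n ∪ l.toFinset).toList.length ≤ n + 1 + l.length := by
      rw [Finset.length_toList]
      refine (Finset.card_union_le _ _).trans (Nat.add_le_add ?_ l.toFinset_card_le)
      refine (Finset.card_insert_le _ _).trans (Nat.succ_le_succ ?_)
      exact Finset.card_image_le.trans (by simp)
    have h1 : l.length * (6 * L ^ 3) ≤ 2 ^ (k + 1) * L ^ 2 * (6 * L ^ 3) :=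
      Nat.mul_le_mul_right _ (hlen.trans (Nat.mul_le_mul_left _
        (Nat.pow_le_pow_left (by omega) 2)))
    have h2 : (n + 1 + l.length) * (L * L) ≤
        (2 ^ (k + 1) + 2 ^ (k + 1) * L ^ 2) * (L * L) := by
      refine Nat.mul_le_mul_right _ (Nat.add_le_add ?_ (hlen.trans (Nat.mul_le_mul_left _
        (Nat.pow_le_pow_left (by omega) 2))))
      have := Nat.one_le_two_pow (n := k)
      rw [pow_succ]
      omega
    have h3 : L ^ 2 ≤ L ^ 5 := Nat.pow_le_pow_right hL1 (by norm_num)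
    have h4 : L ^ 4 ≤ L ^ 5 := Nat.pow_le_pow_right hL1 (by norm_num)
    simp only [List.length_append, length_invCircuit]
    -- The factor `4` stands for two chains, each run forwards and backwards.
    calc _ ≤ 4 * (l.length * (6 * L ^ 3)) + (n + 1 + l.length) * (L * L) := by
          have := hcD.trans (Nat.mul_le_mul_right _ hcard)
          omega
      _ ≤ 4 * (2 ^ (k + 1) * L ^ 2 * (6 * L ^ 3)) +
          (2 ^ (k + 1) + 2 ^ (k + 1) * L ^ 2) * (L * L) := by omega
      _ = 2 ^ (k + 1) * (24 * L ^ 5 + L ^ 2 + L ^ 4) := by ring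
      _ ≤ 2 ^ (k + 1) * (26 * L ^ 5) := Nat.mul_le_mul_left _ (by omega)
      _ = _ := by ring
  · have hq : queryCount (c₁ ++ c₂) = 0 := by rw [queryCount_append, hq₁, hq₂]
    refine implements_diagonal ?_ fun F x => ?_
    · rw [queryCount_append, queryCount_append, queryCount_invCircuit, hq, hgD.1]
    · have hrun : run F (c₁ ++ c₂) (ket (zext x)) = ket (e₂ x) := by
        rw [run_append, hrun₁, hrun₂]
      rw [run_append, run_append, hrun, hgD.2, run_smul, ← hrun, run_invCircuit hq, hg]
      congr 4
      have hpair : ∀ (v : Fin n → Option (Fin d × Fin q)) (u : Fin n → ℤ),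
          ((pairing (bitVal v x) u : ℤ) : ℝ) = pairing (fun i => (bitVal v x i : ℝ)) u :=
        fun v u => by simp [pairing]
      rw [hprod, Finset.mul_sum, Finset.sum_map_toList]
      refine Finset.sum_congr rfl fun u _ => ?_
      rw [hpair, hpair, mul_assoc]

/-- Both registers are padded with absent bits to the common length `h + g`. The choice `k = log (h
+ g) + 2` satisfies `2 * n ≤ 2 ^ k` and keeps `2 ^ (k + 1)` at most `8 * (h + g)`, whence `208 = 26
* 8`. -/
theorem exists_phase_product_reg {h g B : ℕ} (hh : 1 ≤ h) (hB : h + g ≤ B)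
    (hw : workSize (Nat.log 2 B + 2) ≤ w) (v : Fin h → Fin d × Fin q) (v' : Fin g → Fin d × Fin q)
    (θ : ℝ) : ∃ c : Circuit d q m w, c.length ≤ (h + g) * (208 * (Nat.log 2 B + 4) ^ 5) ∧
      Implements c (Matrix.diagonal fun x =>
        Complex.exp (Complex.I * ((θ * (regVal v x * regVal v' x) : ℝ)))) := by
  set k := Nat.log 2 (h + g) + 2 with hk
  have hlog : Nat.log 2 (h + g) ≤ Nat.log 2 B := Nat.log_mono_right hB
  have hlt := Nat.lt_pow_succ_log_self one_lt_two (h + g)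
  have hle := Nat.pow_log_le_self 2 (x := h + g) (by omega)
  have hwk : workSize k ≤ w := by
    refine le_trans ?_ hw
    unfold workSize
    gcongr <;> omega
  have hreg : ∀ {n : ℕ} (hn : n ≤ h + g) (v : Fin n → Fin d × Fin q) (x : MeshIndex d q),
      ∑ i : Fin (h + g), 2 ^ (i : ℕ) * (bitVal (fun i : Fin (h + g) =>
        if hi : (i : ℕ) < n then some (v ⟨i, hi⟩) else none) x i : ℝ) = regVal v x := by
    intro n hn v x
    obtain ⟨t, ht⟩ := Nat.exists_eq_add_of_le hn
    rw [ht, Fin.sum_univ_add, Finset.sum_eq_zero (s := Finset.univ (α := Fin t)), add_zero]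
    · simp [regVal, bitVal]
    · simp [bitVal]
  obtain ⟨c, hc, hcI⟩ := exists_phase_product (n := h + g) (m := m) (k := k)
    (by rw [hk, pow_succ, mul_comm]; exact Nat.mul_le_mul_right _ hlt.le) hwk
    (fun i => if hi : (i : ℕ) < h then some (v ⟨i, hi⟩) else none)
    (fun i => if hi : (i : ℕ) < g then some (v' ⟨i, hi⟩) else none) θ
  refine ⟨c, hc.trans ?_, ?_⟩
  · calc 26 * 2 ^ (k + 1) * (k + 2) ^ 5 = 2 ^ Nat.log 2 (h + g) * (208 * (k + 2) ^ 5) := by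
          rw [hk]; ring
      _ ≤ (h + g) * (208 * (Nat.log 2 B + 4) ^ 5) := by
          have hk2 : k + 2 ≤ Nat.log 2 B + 4 := by omega
          exact Nat.mul_le_mul hle (Nat.mul_le_mul_left _ (Nat.pow_le_pow_left hk2 5))
  · simpa only [hreg (Nat.le_add_right h g), hreg (Nat.le_add_left g h)] using hcI

end Adder

section Operators

variable {d q m w : ℕ}

/-! ### Permutations of the coordinate wires -/

/-- The matrix that permutes the wires. -/
def permMat {ι : Type} [Fintype ι] [DecidableEq ι] (σ : Equiv.Perm ι) :
    Matrix (ι → Bool) (ι → Bool) ℂ :=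
  Matrix.of fun x y => if (fun r => x (σ r)) = y then 1 else 0

theorem permMat_mul {ι : Type} [Fintype ι] [DecidableEq ι] (σ : Equiv.Perm ι)
    (M : Matrix (ι → Bool) (ι → Bool) ℂ) :
    permMat σ * M = Matrix.of fun x y => M (fun r => x (σ r)) y := by
  ext x y
  simp [Matrix.mul_apply, permMat]

theorem permMat_mul_permMat {ι : Type} [Fintype ι] [DecidableEq ι] (σ τ : Equiv.Perm ι) :
    permMat σ * permMat τ = permMat (σ * τ) := by
  rw [permMat_mul]
  rfl

theorem permMat_one {ι : Type} [Fintype ι] [DecidableEq ι] :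
    permMat (1 : Equiv.Perm ι) = 1 := by
  ext x y
  rw [Matrix.one_apply]
  rfl

/-- The swap gate. -/
noncomputable def swapUnitary : Matrix.unitaryGroup (Bool × Bool) ℂ :=
  ⟨Matrix.of fun a c => if a.swap = c then 1 else 0, by
    rw [Matrix.mem_unitaryGroup_iff]
    ext a c
    simp [Matrix.mul_apply, Matrix.star_apply, Matrix.one_apply, Prod.swap_inj, eq_comm]⟩

theorem implements_swap {r r' : Fin d × Fin q} (h : r ≠ r') :
    ∃ c : Circuit d q m w, c.length = 1 ∧ Implements c (permMat (Equiv.swap r r')) := by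
  refine ⟨[.two (.inl r) (.inl r') (by simpa using h) swapUnitary], rfl, rfl, fun F ψ => ?_⟩
  ext x
  change ∑ c, swapUnitary.1 (x (.inl r), x (.inl r')) c * withZeros ψ
    (Function.update (Function.update x (.inl r) c.1) (.inl r') c.2) = _
  simp only [swapUnitary, Matrix.of_apply, Prod.swap_prod_mk, ite_mul, one_mul, zero_mul,
    Finset.sum_ite_eq, Finset.mem_univ, if_true]
  have h1 : (fun k : Fin d × Fin q => Function.update (Function.update x (.inl r) (x (.inl r')))
      (.inl r') (x (.inl r)) (.inl k)) = fun k => x (.inl (Equiv.swap r r' k)) := by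
    funext k
    by_cases hk : k = r
    · subst hk
      simp [h]
    · by_cases hk' : k = r'
      · subst hk'
        simp
      · simp [hk, hk', Equiv.swap_apply_of_ne_of_ne]
  have h2 : act (permMat (Equiv.swap r r')) ψ =
      WithLp.toLp 2 fun y => ψ fun k => y (Equiv.swap r r' k) := by
    ext y
    simp [act, permMat, Matrix.mulVec, dotProduct]
  rw [h2]
  simp only [withZeros, h1, ne_eq, reduceCtorEq, not_false_eq_true, Function.update_of_ne]

/-- Composing with the swap of `a` and `σ a` makes `a` a fixed point, so each swap removes one
element from the support. -/
theorem exists_implements_permMat (S : Finset (Fin d × Fin q)) :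
    ∀ σ : Equiv.Perm (Fin d × Fin q), (∀ r, r ∉ S → σ r = r) →
    ∃ c : Circuit d q m w, c.length ≤ S.card ∧ Implements c (permMat σ) := by
  induction S using Finset.induction_on with
  | empty =>
    intro σ hσ
    have : σ = 1 := Equiv.ext fun r => hσ r (by simp)
    exact ⟨[], le_rfl, by rw [this, permMat_one]; exact Implements.nil⟩
  | insert a S ha ih =>
    intro σ hσ
    rw [Finset.card_insert_of_notMem ha]
    by_cases hfix : σ a = a
    · obtain ⟨c, hc, h⟩ := ih σ fun r hr => by
        by_cases hra : r = a
        · rw [hra, hfix]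
        · exact hσ r (by simp [hra, hr])
      exact ⟨c, by omega, h⟩
    · obtain ⟨c, hc, h⟩ := ih (Equiv.swap a (σ a) * σ) fun r hr => by
        by_cases hra : r = a
        · simp [hra]
        · have hr' := hσ r (by simp [hra, hr])
          rw [Equiv.Perm.mul_apply, hr', Equiv.swap_apply_of_ne_of_ne hra]
          intro h
          rw [h] at hr'
          exact hra (h.trans (σ.injective hr'))
      obtain ⟨c', hc', h'⟩ := implements_swap (m := m) (w := w) (Ne.symm hfix)
      refine ⟨c ++ c', by simp; omega, ?_⟩
      have := h.append h'
      rwa [permMat_mul_permMat, ← mul_assoc, Equiv.swap_mul_self, one_mul] at this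

/-! ### The shifted Fourier transform -/

/-- The wires of one coordinate. -/
def coordReg (j : Fin d) : Fin q → Fin d × Fin q := fun i => (j, i)

/-- The kernel of the Fourier transform on the register of one coordinate. -/
noncomputable def coordKernel (x y : MeshIndex d q) (j : Fin d) : ℂ :=
  ((Real.sqrt (2 ^ q) : ℝ) : ℂ)⁻¹ * Complex.exp (2 * Real.pi * Complex.I *
    (regVal (coordReg j) y * regRev (coordReg j) x) / 2 ^ q)

theorem fourierBlock_mul_coord {J : Finset (Fin d)} {j : Fin d} (hj : j ∉ J) :
    fourierBlock (coordReg (q := q) j) *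
      blockMat (J ×ˢ Finset.univ) (fun x y => ∏ j ∈ J, coordKernel x y j) =
    blockMat (insert j J ×ˢ Finset.univ) fun x y => ∏ j ∈ insert j J, coordKernel x y j := by
  have himg : Finset.univ.image (coordReg (q := q) j) = {j} ×ˢ Finset.univ := by
    ext ⟨a, i⟩
    simp [coordReg, eq_comm]
  have hdisj : Disjoint (({j} : Finset (Fin d)) ×ˢ (Finset.univ : Finset (Fin q)))
      (J ×ˢ Finset.univ) := by
    rw [Finset.disjoint_left]
    rintro ⟨a, i⟩ h1 h2
    simp only [Finset.mem_product, Finset.mem_singleton, Finset.mem_univ, and_true] at h1 h2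
    exact hj (h1 ▸ h2)
  rw [fourierBlock, himg, blockMat_mul hdisj, ← Finset.union_product, ← Finset.insert_eq]
  refine blockMat_congr fun x y => ?_
  rw [Finset.prod_insert hj]
  set z := (({j} : Finset (Fin d)) ×ˢ (Finset.univ : Finset (Fin q))).piecewise y x with hz
  have hzj : ∀ i, z (coordReg j i) = y (coordReg j i) := fun i => by
    rw [hz, Finset.piecewise_eq_of_mem]
    simp [coordReg]
  have hzJ : ∀ a ∈ J, ∀ i, z (coordReg a i) = x (coordReg a i) := fun a ha i => by
    rw [hz, Finset.piecewise_eq_of_notMem]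
    simp only [coordReg, Finset.mem_product, Finset.mem_singleton, Finset.mem_univ, and_true]
    rintro rfl
    exact hj ha
  congr 1
  · simp only [coordKernel, regVal, hzj]
  · refine Finset.prod_congr rfl fun a ha => ?_
    simp only [coordKernel, regRev, hzJ a ha]

/-- The reversal of the bits of each coordinate. -/
def revPerm (d q : ℕ) : Equiv.Perm (Fin d × Fin q) := Equiv.prodCongr 1 Fin.revPerm

theorem regRev_revPerm (x : MeshIndex d q) (j : Fin d) :
    regRev (coordReg j) (fun r => x (revPerm d q r)) = coordVal x j := by
  rw [regRev, coordVal, ← Equiv.sum_comp Fin.revPerm]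
  refine Finset.sum_congr rfl fun i _ => ?_
  have : q - 1 - (Fin.rev i : ℕ) = i := by
    rw [Fin.val_rev]
    omega
  rw [Fin.revPerm_apply, this]
  change (if x (j, Fin.rev (Fin.rev i)) then _ else _) = _
  rw [Fin.rev_rev]

/-- The linear form `∑ j, coordVal x j` on the coordinate wires. -/
noncomputable def coordList (d q m w : ℕ) : List (Qubit d q m w × ℝ) :=
  (Finset.univ : Finset (Fin d × Fin q)).toList.map fun r => (.inl r, 2 ^ (r.2 : ℕ))

theorem length_coordList : (coordList d q m w).length = d * q := by
  simp [coordList]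

theorem wireVal_coordList (x : MeshIndex d q) :
    wireVal (coordList d q m w) (zext x) = ∑ j, (coordVal x j : ℝ) := by
  rw [wireVal, coordList, List.map_map]
  change ((Finset.univ : Finset (Fin d × Fin q)).toList.map
    (fun r => if x r then (2 : ℝ) ^ (r.2 : ℕ) else 0)).sum = _
  rw [Finset.sum_map_toList, Fintype.sum_prod_type]
  simp [coordVal]

/-- The frequency shift by `2 ^ q / 2` contributes `exp (-π i x j)` in coordinate `j`, a phase
linear in the output bits; the permutation undoes the bit reversal of the blocks. -/
theorem qsft_eq : qsft d q = Matrix.diagonal (fun x => Complex.exp (Complex.I *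
      ((-Real.pi * ∑ j, (coordVal x j : ℝ) : ℝ)))) *
    (permMat (revPerm d q) *
      blockMat (Finset.univ ×ˢ Finset.univ) fun x y => ∏ j, coordKernel x y j) := by
  rw [permMat_mul]
  ext x k
  simp only [qsft, Matrix.of_apply, Matrix.diagonal_mul, blockMat, Finset.mem_product,
    Finset.mem_univ, and_self, not_true, IsEmpty.forall_iff, implies_true, if_true, coordKernel,
    regRev_revPerm]
  have : Complex.exp (Complex.I * ((-Real.pi * ∑ j, (coordVal x j : ℝ) : ℝ))) =
      ∏ j, Complex.exp (Complex.I * (-Real.pi * (coordVal x j : ℂ))) := by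
    rw [← Complex.exp_sum]
    push_cast
    simp only [Finset.mul_sum]
  rw [this, ← Finset.prod_mul_distrib]
  refine Finset.prod_congr rfl fun j _ => ?_
  have hval : regVal (coordReg j) k = coordVal k j := rfl
  rw [mul_left_comm, ← Complex.exp_add, hval]
  congr 2
  have h2 : (2 : ℂ) ^ q ≠ 0 := pow_ne_zero _ two_ne_zero
  simp only [freq]
  push_cast
  field_simp
  ring

/-- The bound on the cost of a product phase, per qubit. -/
def phaseCost (q : ℕ) : ℕ := 208 * (Nat.log 2 (2 * q) + 4) ^ 5

/-- The number of work qubits of the circuits. -/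
def workBound (q : ℕ) : ℕ := workSize (Nat.log 2 (2 * q) + 2)

theorem exists_implements_qsft (hq : 1 ≤ q) (hw : workBound q ≤ w) :
    ∃ c : Circuit d q m w,
      c.length ≤ d * (q * ((Nat.log 2 q + 1) * phaseCost q + 1)) + d * q + d * q ∧
      Implements c (qsft d q) := by
  have hblock : ∀ j : Fin d, ∃ c : Circuit d q m w,
      c.length ≤ q * ((Nat.log 2 q + 1) * phaseCost q + 1) ∧
      Implements c (fourierBlock (coordReg j)) := fun j => by
    refine fourierBlock_cost (fun a M => ∃ c : Circuit d q m w, c.length ≤ a ∧ Implements c M)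
      ?_ ?_ ?_ (X := phaseCost q) (B := 2 * q) ?_ _ q (coordReg j) ?_ hq
      (Nat.lt_pow_succ_log_self one_lt_two q).le (by omega)
    · rintro a b M hab ⟨c, hc, h⟩
      exact ⟨c, hc.trans hab, h⟩
    · rintro a b M N ⟨c, hc, h⟩ ⟨c', hc', h'⟩
      exact ⟨c ++ c', by simp; omega, h.append h'⟩
    · intro v
      rw [fourierBlock_one]
      exact ⟨_, le_rfl, implements_one _ _⟩
    -- Reading the high wires backwards turns the reversed value into an ordinary one, to which the
    -- product phase applies.
    · intro h g lo hi θ hh _ hB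
      obtain ⟨c, hc, hI⟩ := exists_phase_product_reg (m := m) hh hB hw lo
        (fun i => hi (Fin.rev i)) θ
      refine ⟨c, hc, ?_⟩
      have : ∀ z, regRev hi z = regVal (fun i => hi (Fin.rev i)) z := fun z => by
        rw [regRev, regVal, ← Equiv.sum_comp Fin.revPerm]
        refine Finset.sum_congr rfl fun i _ => ?_
        have : g - 1 - (Fin.rev i : ℕ) = i := by
          rw [Fin.val_rev]
          omega
        rw [Fin.revPerm_apply, this]
      simpa only [this] using hI
    · intro i i' h
      exact (Prod.ext_iff.1 h).2
  have hall : ∀ J : Finset (Fin d), ∃ c : Circuit d q m w,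
      c.length ≤ J.card * (q * ((Nat.log 2 q + 1) * phaseCost q + 1)) ∧
      Implements c (blockMat (J ×ˢ Finset.univ) fun x y => ∏ j ∈ J, coordKernel x y j) := by
    intro J
    induction J using Finset.induction_on with
    | empty =>
      refine ⟨[], by simp, ?_⟩
      convert Implements.nil
      ext x y
      simp [blockMat, Matrix.one_apply, funext_iff]
    | insert j J hj ih =>
      obtain ⟨c, hc, h⟩ := ih
      obtain ⟨c', hc', h'⟩ := hblock j
      refine ⟨c ++ c', ?_, fourierBlock_mul_coord hj ▸ h.append h'⟩
      rw [List.length_append, Finset.card_insert_of_notMem hj, Nat.succ_mul]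
      omega
  obtain ⟨c₁, hc₁, h₁⟩ := hall Finset.univ
  obtain ⟨c₂, hc₂, h₂⟩ := exists_implements_permMat (m := m) (w := w) Finset.univ (revPerm d q)
    (by simp)
  obtain ⟨c₃, hc₃, h₃⟩ := exists_phase_linear (-Real.pi) (coordList d q m w)
  have h₃' := h₃.implements
  simp only [wireVal_coordList] at h₃'
  refine ⟨c₁ ++ c₂ ++ c₃, ?_, ?_⟩
  · rw [Finset.card_univ, Fintype.card_fin] at hc₁
    rw [Finset.card_univ, Fintype.card_prod, Fintype.card_fin, Fintype.card_fin] at hc₂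
    rw [length_coordList] at hc₃
    rw [List.length_append, List.length_append]
    omega
  · rw [qsft_eq]
    exact (h₁.append h₂).append h₃'

/-! ### The kinetic phase -/

theorem Implements.diagonal_append {c c' : Circuit d q m w} {g g' : MeshIndex d q → ℝ}
    (h : Implements c (Matrix.diagonal fun x => Complex.exp (Complex.I * g x)))
    (h' : Implements c' (Matrix.diagonal fun x => Complex.exp (Complex.I * g' x))) :
    Implements (c ++ c') (Matrix.diagonal fun x =>
      Complex.exp (Complex.I * ((g x + g' x : ℝ)))) := by
  have := h.append h'
  rw [Matrix.diagonal_mul_diagonal] at this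
  refine Eq.mp (congrArg (fun f => Implements _ (Matrix.diagonal f)) (funext fun x => ?_)) this
  rw [← Complex.exp_add]
  push_cast
  ring_nf

theorem exp_smul_diagonal {X : Type} [Fintype X] [DecidableEq X] (a : ℝ) (g : X → ℝ) :
    NormedSpace.exp ((-(Complex.I * a)) • Matrix.diagonal fun x => (g x : ℂ)) =
      Matrix.diagonal fun x => Complex.exp (Complex.I * ((-a * g x : ℝ))) := by
  rw [← Matrix.diagonal_smul, Matrix.exp_diagonal]
  congr 1
  funext x
  rw [Pi.exp_def]
  simp only [Pi.smul_apply, smul_eq_mul, ← Complex.exp_eq_exp_ℂ]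
  push_cast
  ring_nf

/-- Expanding `(k - 2 ^ q / 2) ^ 2` gives the product of a register with itself, a linear term and a
constant. -/
theorem exists_implements_kinetic (hd : 1 ≤ d) (hq : 1 ≤ q) (hw : workBound q ≤ w) (a b s : ℝ)
    (φ : ℝ → ℝ) (j : ℕ) : ∃ c : Circuit d q m w,
      c.length ≤ d * (2 * q * phaseCost q) + d * q + 1 ∧
      Implements c (kineticPhase d q a b s φ j) := by
  set θ : ℝ := -(s * Real.exp (φ (j * s))) * (1 / 2 * (2 * Real.pi / (b - a)) ^ 2) with hθ
  have hone : ∀ i : Fin d, ∃ c : Circuit d q m w, c.length ≤ 2 * q * phaseCost q ∧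
      Implements c (Matrix.diagonal fun x => Complex.exp (Complex.I *
        ((θ * (coordVal x i * coordVal x i) : ℝ)))) := fun i => by
    obtain ⟨c, hc, h⟩ := exists_phase_product_reg (m := m) hq (by omega : q + q ≤ 2 * q) hw
      (coordReg i) (coordReg i) θ
    exact ⟨c, by rw [two_mul]; simpa [phaseCost] using hc, h⟩
  have hall : ∀ J : Finset (Fin d), ∃ c : Circuit d q m w,
      c.length ≤ J.card * (2 * q * phaseCost q) ∧
      Implements c (Matrix.diagonal fun x => Complex.exp (Complex.I *
        ((∑ i ∈ J, θ * (coordVal x i * coordVal x i) : ℝ)))) := by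
    intro J
    induction J using Finset.induction_on with
    | empty => exact ⟨[], by simp, by simpa using Implements.nil⟩
    | insert i J hi ih =>
      obtain ⟨c, hc, h⟩ := ih
      obtain ⟨c', hc', h'⟩ := hone i
      refine ⟨c' ++ c, ?_, by simpa only [Finset.sum_insert hi] using h'.diagonal_append h⟩
      rw [List.length_append, Finset.card_insert_of_notMem hi, Nat.succ_mul]
      omega
  obtain ⟨c₁, hc₁, h₁⟩ := hall Finset.univ
  obtain ⟨c₂, hc₂, h₂⟩ := exists_phase_linear (-θ * 2 ^ q) (coordList d q m w)
  -- The constant is a global phase, realized by a scalar gate on one qubit, which exists because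
  -- `d` and `q` are positive.
  obtain ⟨c₃, hc₃, h₃⟩ := exists_phase_one (m := m) (w := w)
    (.inl ((⟨0, hd⟩ : Fin d), (⟨0, hq⟩ : Fin q))) fun _ => θ * (d * (2 ^ q / 2) ^ 2)
  have h := (h₁.diagonal_append h₂.implements).diagonal_append h₃.implements
  refine ⟨c₁ ++ c₂ ++ c₃, ?_, ?_⟩
  · rw [Finset.card_univ, Fintype.card_fin] at hc₁
    rw [length_coordList] at hc₂
    rw [List.length_append, List.length_append]
    omega
  · convert h using 1
    have he : -(Complex.I * s * Real.exp (φ (j * s))) =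
        -(Complex.I * ((s * Real.exp (φ (j * s)) : ℝ) : ℂ)) := by
      push_cast
      ring
    rw [kineticPhase, he, kinetic, exp_smul_diagonal]
    congr 1
    funext x
    congr 3
    rw [wireVal_coordList]
    have hsum : ∑ i, (2 * Real.pi * freq x i / (b - a)) ^ 2 = (2 * Real.pi / (b - a)) ^ 2 *
        (∑ i, (coordVal x i * coordVal x i : ℝ) - 2 ^ q * ∑ i, (coordVal x i : ℝ) +
          d * (2 ^ q / 2) ^ 2) := by
      have hc : (d : ℝ) * (2 ^ q / 2) ^ 2 = ∑ _i : Fin d, ((2 : ℝ) ^ q / 2) ^ 2 := by simp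
      rw [hc, Finset.mul_sum _ _ ((2 : ℝ) ^ q), ← Finset.sum_sub_distrib,
        ← Finset.sum_add_distrib, Finset.mul_sum]
      refine Finset.sum_congr rfl fun i _ => ?_
      rw [freq]
      ring
    rw [hsum, ← Finset.mul_sum, hθ]
    ring

end Operators

section Potential

variable {d q m w : ℕ}

/-! ### The potential phase -/

/-- The label with mesh index `x`, the number `v` in the value register, and zeros elsewhere. -/
def valueLabel (x : MeshIndex d q) (v : BitVec m) : Qubit d q m w → Bool :=
  Sum.elim x (Sum.elim (fun i => v.getLsb i) fun _ => false)

theorem valueLabel_zero (x : MeshIndex d q) :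
    valueLabel (m := m) (w := w) x 0 = zext x := by
  funext k
  rcases k with r | i | i <;> simp [valueLabel, zext]

/-- The gate that flips a qubit. -/
noncomputable def flipUnitary : Matrix.unitaryGroup Bool ℂ :=
  ⟨Matrix.of fun a c => if (!a) = c then 1 else 0, by
    rw [Matrix.mem_unitaryGroup_iff]
    ext a c
    cases a <;> cases c <;> simp [Matrix.mul_apply, Matrix.star_apply]⟩

theorem apply_flip (F : MeshIndex d q → BitVec m) (i : Qubit d q m w)
    (y : Qubit d q m w → Bool) :
    (Gate.one i flipUnitary).apply F (ket y) = ket (Function.update y i (!y i)) := by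
  ext x
  simp only [Gate.apply, flipUnitary, Matrix.of_apply, ite_mul, one_mul, zero_mul,
    Finset.sum_ite_eq, Finset.mem_univ, if_true, ket, PiLp.single_apply]
  congr 1
  rw [eq_iff_iff]
  constructor
  · rintro rfl
    simp
  · rintro rfl
    simp

/-- Flip all qubits of the value register. -/
noncomputable def flipCircuit (d q m w : ℕ) : Circuit d q m w :=
  (List.finRange m).map fun i => .one (.inr (.inl i)) flipUnitary

theorem run_flip_list (F : MeshIndex d q → BitVec m) (l : List (Fin m)) (hl : l.Nodup)
    (y : Qubit d q m w → Bool) :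
    run F (l.map fun i => .one (.inr (.inl i)) flipUnitary) (ket y) =
      ket (Sum.elim (fun r => y (.inl r)) (Sum.elim
        (fun i => if i ∈ l then !y (.inr (.inl i)) else y (.inr (.inl i)))
        fun i => y (.inr (.inr i)))) := by
  induction l generalizing y with
  | nil =>
    change ket y = _
    congr 1
    funext k
    rcases k with r | i | i <;> simp
  | cons a l ih =>
    rw [List.map_cons, run_cons, apply_flip, ih (List.nodup_cons.1 hl).2]
    have ha := (List.nodup_cons.1 hl).1
    congr 1
    funext k
    rcases k with r | i | i
    · simp
    · by_cases hi : i = a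
      · subst hi
        simp [ha]
      · simp [hi]
    · simp

theorem run_flipCircuit (F : MeshIndex d q → BitVec m) (x : MeshIndex d q) (v : BitVec m) :
    run F (flipCircuit d q m w) (ket (valueLabel x v)) = ket (valueLabel x (~~~v)) := by
  rw [flipCircuit, run_flip_list F _ (List.nodup_finRange m)]
  congr 1
  funext k
  rcases k with r | i | i <;> simp [valueLabel]

/-- The map `queryMap` subtracts because it tells where an amplitude comes from; a basis state moves
by the inverse map, which adds. -/
theorem run_query (F : MeshIndex d q → BitVec m) (x : MeshIndex d q) (v : BitVec m) :
    run F [.query] (ket (valueLabel (w := w) x v)) = ket (valueLabel x (v + F x)) := by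
  ext y
  change ket (valueLabel x v) (queryMap F y) = _
  have h : queryMap F (valueLabel (w := w) x (v + F x)) = valueLabel x v := by
    funext k
    rcases k with r | i | i
    · rfl
    · change (BitVec.ofFnLE (fun i => (v + F x).getLsb i) - F x).getLsb i = v.getLsb i
      rw [ofFnLE_getLsb, add_sub_cancel_right]
    · rfl
  simp only [ket, PiLp.single_apply]
  congr 1
  rw [eq_iff_iff, ← h, (queryMap_bijective F).1.eq_iff]

/-- The rotations are linear in the bits, with weights of two's complement. There is no inverse
query, so subtraction is obtained by conjugating an addition with bit flips. -/
theorem exists_potential (θ : ℝ) : ∃ c : Circuit d q m w, c.length = 2 + 3 * m ∧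
    queryCount c = 2 ∧ ∀ (F : MeshIndex d q → BitVec m) (x : MeshIndex d q),
      run F c (ket (zext x)) =
        Complex.exp (Complex.I * ((θ * ((F x).toInt : ℝ) : ℝ))) • ket (zext x) := by
  obtain ⟨c, hc, h⟩ := exists_phase_linear (m := m) (w := w) θ
    (regList (fun i => (.inr (.inl i) : Qubit d q m w)) (intWeight m))
  have hflip : queryCount (flipCircuit d q m w) = 0 := by
    simp [queryCount, flipCircuit, List.countP_map, Function.comp_def, Gate.isQuery]
  refine ⟨[.query] ++ c ++ flipCircuit d q m w ++ [.query] ++ flipCircuit d q m w, ?_, ?_,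
    fun F x => ?_⟩
  · simp [hc, length_regList, flipCircuit]
    omega
  · simp only [queryCount_append, hflip, h.1]
    rfl
  · rw [← valueLabel_zero]
    simp only [run_append, run_query, zero_add, h.2, run_smul, run_flipCircuit]
    have hv : wireVal (regList (fun i => (.inr (.inl i) : Qubit d q m w)) (intWeight m))
        (valueLabel x (F x)) = (F x).toInt := by
      rw [wireVal_regList]
      have := toInt_ofFnLE_eq_sum fun i => (F x).getLsb i
      rw [ofFnLE_getLsb] at this
      rw [this]
      rfl
    -- Flipping gives `-F x - 1`, the second query turns it into `-1`, all bits one, and flipping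
    -- again clears the register.
    have hz : ~~~(~~~(F x) + F x) = 0 := by
      have hn : ∀ v : BitVec m, ~~~v = -v - 1 := fun v => by
        rw [BitVec.neg_eq_not_add]
        exact (add_sub_cancel_right _ _).symm
      rw [hn, hn]
      ring
    rw [hv, hz]

theorem norm_toLp_mul_le {X : Type} [Fintype X] (c : X → ℂ) (ψ : EuclideanSpace ℂ X) {B : ℝ}
    (hB : 0 ≤ B) (h : ∀ x, ‖c x‖ ≤ B) : ‖WithLp.toLp 2 fun x => c x * ψ x‖ ≤ B * ‖ψ‖ := by
  rw [EuclideanSpace.norm_eq, EuclideanSpace.norm_eq, ← Real.sqrt_sq hB,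
    ← Real.sqrt_mul (sq_nonneg B), Finset.mul_sum]
  refine Real.sqrt_le_sqrt (Finset.sum_le_sum fun x _ => ?_)
  simp only [norm_mul, mul_pow]
  gcongr
  exact h x

theorem norm_exp_sub_exp_le (a b : ℝ) :
    ‖Complex.exp (Complex.I * a) - Complex.exp (Complex.I * b)‖ ≤ |a - b| := by
  have : Complex.exp (Complex.I * a) - Complex.exp (Complex.I * b) =
      Complex.exp (Complex.I * b) * (Complex.exp (Complex.I * ((a - b : ℝ))) - 1) := by
    rw [mul_sub, ← Complex.exp_add]
    push_cast
    ring_nf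
  rw [this, norm_mul, mul_comm Complex.I (b : ℂ), Complex.norm_exp_ofReal_mul_I, one_mul]
  exact Real.norm_exp_I_mul_ofReal_sub_one_le

theorem potentialPhase_eq (a b s : ℝ) (χ : ℝ → ℝ) (f : (Fin d → ℝ) → ℝ) (j : ℕ) :
    potentialPhase (q := q) a b s χ f j = Matrix.diagonal fun x =>
      Complex.exp (Complex.I * ((-(s * Real.exp (χ (j * s))) * f (meshPoint a b x) : ℝ))) := by
  rw [← exp_smul_diagonal, potentialPhase, potential]
  congr 2
  push_cast
  ring

theorem norm_act_potentialPhase (a b s : ℝ) (χ : ℝ → ℝ) (f : (Fin d → ℝ) → ℝ) (j : ℕ)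
    (ψ : QState (Fin d × Fin q)) : ‖act (potentialPhase a b s χ f j) ψ‖ = ‖ψ‖ := by
  rw [EuclideanSpace.norm_eq, EuclideanSpace.norm_eq, potentialPhase_eq]
  congr 1
  refine Finset.sum_congr rfl fun x _ => ?_
  simp only [act, Matrix.mulVec_diagonal, norm_mul]
  rw [mul_comm Complex.I, Complex.norm_exp_ofReal_mul_I, one_mul]

theorem Evaluates.nonneg {F : MeshIndex d q → BitVec m} {f : (Fin d → ℝ) → ℝ} {a b δ η : ℝ}
    (h : Evaluates F f a b δ η) : 0 ≤ η := (abs_nonneg _).trans (h fun _ => false)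

/-- The circuit for the potential phase. -/
theorem exists_implements_potential (a b δ s : ℝ) (hs : 0 < s) (χ : ℝ → ℝ) (j : ℕ) :
    ∃ c : Circuit d q m w, c.length = 2 + 3 * m ∧ queryCount c = 2 ∧
      ∀ (f : (Fin d → ℝ) → ℝ) (F : MeshIndex d q → BitVec m) (η : ℝ),
        Evaluates F f a b δ η → ∀ ψ : QState (Fin d × Fin q),
        ‖run F c (withZeros ψ) - withZeros (act (potentialPhase a b s χ f j) ψ)‖ ≤
          s * Real.exp (χ (j * s)) * η * ‖ψ‖ := by
  set α := s * Real.exp (χ (j * s)) with hα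
  have hα0 : 0 ≤ α := by positivity
  obtain ⟨c, hc, hq, h⟩ := exists_potential (d := d) (q := q) (m := m) (w := w) (-α * δ)
  refine ⟨c, hc, hq, fun f F η hF ψ => ?_⟩
  have h1 : run F c (withZeros ψ) = withZeros (WithLp.toLp 2 fun x =>
      Complex.exp (Complex.I * ((-α * δ * ((F x).toInt : ℝ) : ℝ))) * ψ x) := by
    rw [run_withZeros, withZeros_eq_sum]
    refine Finset.sum_congr rfl fun x _ => ?_
    rw [h, smul_smul, mul_comm]
  rw [h1, ← withZeros_sub, norm_withZeros]
  have h2 : (WithLp.toLp 2 fun x =>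
      Complex.exp (Complex.I * ((-α * δ * ((F x).toInt : ℝ) : ℝ))) * ψ x) -
      act (potentialPhase a b s χ f j) ψ = WithLp.toLp 2 fun x =>
        (Complex.exp (Complex.I * ((-α * δ * ((F x).toInt : ℝ) : ℝ))) -
          Complex.exp (Complex.I * ((-α * f (meshPoint a b x) : ℝ)))) * ψ x := by
    ext x
    rw [potentialPhase_eq]
    simp only [act, Matrix.mulVec_diagonal, PiLp.sub_apply, sub_mul, ← hα]
  rw [h2]
  refine norm_toLp_mul_le _ _ (mul_nonneg hα0 hF.nonneg) fun x => ?_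
  refine (norm_exp_sub_exp_le _ _).trans ?_
  have h3 : -α * δ * ((F x).toInt : ℝ) - -α * f (meshPoint a b x) =
      α * (f (meshPoint a b x) - δ * ((F x).toInt : ℝ)) := by ring
  rw [h3, abs_mul, abs_of_nonneg hα0]
  exact mul_le_mul_of_nonneg_left (hF x) hα0

/-! ### The uniform superposition -/

theorem hadamard_list (l : List (Fin d × Fin q)) (hl : l.Nodup)
    (F : MeshIndex d q → BitVec m) :
    run F (l.map fun r => .one (.inl r) hadamard) (zeroState (Qubit d q m w)) =
      withZeros (WithLp.toLp 2 fun x =>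
        if ∀ r, r ∉ l → x r = false then ((Real.sqrt 2 : ℝ) : ℂ)⁻¹ ^ l.length else 0) := by
  induction l using List.reverseRecOn with
  | nil =>
    have h1 : zeroState (Qubit d q m w) = withZeros (ket fun _ => false) := by
      rw [withZeros_ket]
      change ket _ = ket _
      congr 1
      funext k
      rcases k with r | r <;> rfl
    rw [h1]
    change withZeros _ = _
    congr 1
    ext x
    simp [ket, funext_iff]
  | append_singleton l r ih =>
    have hl' := List.nodup_append.1 hl
    have hr : r ∉ l := fun h => hl'.2.2 r h r (by simp) rfl
    rw [List.map_append, run_append, ih hl'.1, List.map_singleton, (implements_one r hadamard).2]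
    congr 1
    ext x
    simp only [act, blockMat_singleton_mulVec, Fintype.sum_bool]
    have h1 : ¬ ∀ k, k ∉ l → Function.update x r true k = false := fun h => by
      simpa using h r hr
    have h2 : (∀ k, k ∉ l → Function.update x r false k = false) ↔
        ∀ k, k ∉ l ++ [r] → x k = false := by
      refine forall_congr' fun k => ?_
      by_cases hk : k = r
      · subst hk
        simp
      · simp [hk]
    rw [if_neg h1]
    simp only [h2]
    split_ifs
    · simp [hadamard, pow_succ, mul_comm]
    · simp

theorem exists_uniform : ∃ prep : Circuit d q m w, gateCount prep = d * q ∧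
    ∀ F : MeshIndex d q → BitVec m,
      run F prep (zeroState (Qubit d q m w)) = withZeros (uniformState d q) := by
  refine ⟨(Finset.univ : Finset (Fin d × Fin q)).toList.map fun r => .one (.inl r) hadamard,
    by simp [gateCount], fun F => ?_⟩
  rw [hadamard_list _ (Finset.nodup_toList _)]
  congr 1
  ext x
  have h : Real.sqrt 2 ^ (d * q) = Real.sqrt (2 ^ (d * q)) := by
    rw [eq_comm, Real.sqrt_eq_iff_mul_self_eq (by positivity) (by positivity), ← mul_pow]
    simp
  simp [uniformState, ← h]

/-! ### Measurement -/

theorem outcomeProb_withZeros (φ : QState (Fin d × Fin q)) (x : MeshIndex d q) :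
    outcomeProb (withZeros (m := m) (w := w) φ) x = ‖φ x‖ ^ 2 := by
  rw [outcomeProb, Finset.sum_eq_single fun _ => false]
  · simp [withZeros]
  · intro y _ hy
    have : ¬ ∀ r, y r = false := fun h => hy (funext h)
    simp only [withZeros, Sum.elim_inr, this, if_false, norm_zero, ne_eq, OfNat.ofNat_ne_zero,
      not_false_eq_true, zero_pow]
  · simp

theorem sum_norm_mul_norm_le {X : Type} [Fintype X] (ψ φ : EuclideanSpace ℂ X) :
    ∑ x, ‖ψ x‖ * ‖φ x‖ ≤ ‖ψ‖ * ‖φ‖ := by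
  rw [EuclideanSpace.norm_eq, EuclideanSpace.norm_eq]
  exact Real.sum_mul_le_sqrt_mul_sqrt _ _ _

/-- Each difference of squared moduli factors as a difference times a sum; the Cauchy–Schwarz
inequality then bounds the total. For unit vectors this is twice the distance. -/
theorem sum_abs_outcomeProb_sub_le (Ψ : QState (Qubit d q m w)) (φ : QState (Fin d × Fin q)) :
    ∑ x, |outcomeProb Ψ x - ‖φ x‖ ^ 2| ≤
      ‖Ψ - withZeros φ‖ * ‖Ψ‖ + ‖Ψ - withZeros φ‖ * ‖φ‖ := by
  set Φ : QState (Qubit d q m w) := withZeros φ with hΦ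
  rw [← norm_withZeros (m := m) (w := w) φ, ← hΦ]
  calc ∑ x, |outcomeProb Ψ x - ‖φ x‖ ^ 2|
      = ∑ x, |∑ y : Fin m ⊕ Fin w → Bool,
          (‖Ψ (Sum.elim x y)‖ ^ 2 - ‖Φ (Sum.elim x y)‖ ^ 2)| := by
        refine Finset.sum_congr rfl fun x _ => ?_
        rw [← outcomeProb_withZeros (m := m) (w := w), Finset.sum_sub_distrib]
        rfl
    _ ≤ ∑ x, ∑ y : Fin m ⊕ Fin w → Bool,
          (‖(Ψ - Φ) (Sum.elim x y)‖ * ‖Ψ (Sum.elim x y)‖ +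
            ‖(Ψ - Φ) (Sum.elim x y)‖ * ‖Φ (Sum.elim x y)‖) := by
        refine Finset.sum_le_sum fun x _ => (Finset.abs_sum_le_sum_abs _ _).trans
          (Finset.sum_le_sum fun y _ => ?_)
        rw [sq_sub_sq, abs_mul, mul_comm, abs_of_nonneg (add_nonneg (norm_nonneg (Ψ _)) (norm_nonneg (Φ _))),
          ← mul_add]
        exact mul_le_mul_of_nonneg_right (abs_norm_sub_norm_le _ _)
          (add_nonneg (norm_nonneg _) (norm_nonneg _))
    _ = ∑ z, (‖(Ψ - Φ) z‖ * ‖Ψ z‖ + ‖(Ψ - Φ) z‖ * ‖Φ z‖) := by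
        rw [← Fintype.sum_prod_type', ← (Equiv.sumArrowEquivProdArrow _ _ Bool).symm.sum_comp]
        rfl
    _ ≤ _ := by
        rw [Finset.sum_add_distrib]
        exact add_le_add (sum_norm_mul_norm_le _ _) (sum_norm_mul_norm_le _ _)

/-! ### The iteration -/

theorem iterationCircuit_succ (pot kin : ℕ → Circuit d q m w) (ift ft : Circuit d q m w)
    (R : ℕ) : iterationCircuit pot kin ift ft (R + 1) =
      iterationCircuit pot kin ift ft R ++ (pot R ++ ift ++ kin R ++ ft) := by
  simp [iterationCircuit, List.range_succ, List.flatMap_append]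

theorem length_iterationCircuit_le {pot kin : ℕ → Circuit d q m w} {ift ft : Circuit d q m w}
    {n : ℕ} (h : ∀ j, (pot j ++ ift ++ kin j ++ ft).length ≤ n) (R : ℕ) :
    (iterationCircuit pot kin ift ft R).length ≤ R * n := by
  induction R with
  | zero => simp [iterationCircuit]
  | succ R ih =>
    rw [iterationCircuit_succ, List.length_append, Nat.succ_mul]
    exact Nat.add_le_add ih (h R)

variable {a b s : ℝ} {φ χ : ℝ → ℝ} {f : (Fin d → ℝ) → ℝ} {pot kin : ℕ → Circuit d q m w}
  {ift ft : Circuit d q m w}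

theorem norm_iterate (hift : Implements ift (qsft d q)⁻¹) (hft : Implements ft (qsft d q))
    (hkin : ∀ j, Implements (kin j) (kineticPhase d q a b s φ j)) (ψ₀ : QState (Fin d × Fin q))
    (R : ℕ) : ‖iterate a b s φ χ f ψ₀ R‖ = ‖ψ₀‖ := by
  induction R with
  | zero => rfl
  | succ R ih =>
    rw [iterate, ← act_act, (hift.append ((hkin R).append hft)).norm_act, norm_act_potentialPhase, ih]

/-- The old error is transported by norm-preserving circuits and keeps its size. The new error is
measured on the ideal state, where all other qubits are zero and `hpot` applies. -/
theorem norm_run_iterationCircuit_sub_le (hift : Implements ift (qsft d q)⁻¹)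
    (hft : Implements ft (qsft d q))
    (hkin : ∀ j, Implements (kin j) (kineticPhase d q a b s φ j)) {F : MeshIndex d q → BitVec m}
    {ε : ℕ → ℝ} (hpot : ∀ (j : ℕ) (ψ : QState (Fin d × Fin q)),
      ‖run F (pot j) (withZeros ψ) - withZeros (act (potentialPhase a b s χ f j) ψ)‖ ≤
        ε j * ‖ψ‖) {ψ₀ : QState (Fin d × Fin q)} (hψ₀ : ‖ψ₀‖ = 1) (R : ℕ) :
    ‖run F (iterationCircuit pot kin ift ft R) (withZeros ψ₀) -
      withZeros (iterate a b s φ χ f ψ₀ R)‖ ≤ ∑ j ∈ Finset.range R, ε j := by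
  induction R with
  | zero => simp [iterationCircuit, run, iterate]
  | succ R ih =>
    set Φ := run F (iterationCircuit pot kin ift ft R) (withZeros ψ₀) with hΦ
    set ψ := iterate a b s φ χ f ψ₀ R with hψ
    have htail := (hift.append (hkin R)).append hft
    have h1 : withZeros (iterate a b s φ χ f ψ₀ (R + 1)) = run F (ift ++ kin R ++ ft)
        (withZeros (act (potentialPhase a b s χ f R) ψ)) := by
      rw [htail.2, act_act, iterate]
      simp only [mul_assoc, hψ]
    have h2 : run F (iterationCircuit pot kin ift ft (R + 1)) (withZeros ψ₀) =
        run F (ift ++ kin R ++ ft) (run F (pot R) Φ) := by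
      rw [iterationCircuit_succ, hΦ]
      simp only [run_append]
    rw [h1, h2, ← run_sub, norm_run, Finset.sum_range_succ]
    have h3 : ‖run F (pot R) Φ - run F (pot R) (withZeros ψ)‖ = ‖Φ - withZeros ψ‖ := by
      rw [← run_sub, norm_run]
    have h4 := hpot R ψ
    rw [norm_iterate hift hft hkin, hψ₀, mul_one] at h4
    refine (norm_sub_le_norm_sub_add_norm_sub _ (run F (pot R) (withZeros ψ)) _).trans ?_
    rw [h3]
    exact add_le_add ih h4

end Potential

/-! ### Cost bounds -/

theorem one_add_log_le {a b : ℕ} (h : a ≤ b) : Nat.log 2 a + 1 ≤ Nat.log 2 b + 1 :=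
  Nat.succ_le_succ (Nat.log_mono_right h)

theorem iteration_cost_le {d q m K : ℕ} (hd : 1 ≤ d) (hq : 1 ≤ q)
    (hm : m ≤ softBound K K (d * q)) :
    (2 + 3 * m) + (d * (q * ((Nat.log 2 q + 1) * phaseCost q + 1)) + d * q + d * q) +
      (d * (2 * q * phaseCost q) + d * q + 1) +
      (d * (q * ((Nat.log 2 q + 1) * phaseCost q + 1)) + d * q + d * q) ≤
    softBound (2600011 + 3 * K) (K + 6) (d * q) := by
  set n := d * q with hn
  have hn1 : 1 ≤ n := Nat.mul_pos hd hq
  set t := Nat.log 2 n + 1 with ht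
  have ht1 : 1 ≤ t := by omega
  have hlog : Nat.log 2 q + 1 ≤ t := one_add_log_le (Nat.le_mul_of_pos_left q hd)
  have hphase : phaseCost q ≤ 650000 * t ^ 5 := by
    -- The left side is `log q + 5`, at most `t + 4`, and `t ≥ 1`. Then `208 * 5 ^ 5 = 650000`.
    have h1 : Nat.log 2 (2 * q) + 4 ≤ 5 * t := by
      rw [mul_comm, Nat.log_mul_base one_lt_two (by omega)]
      omega
    calc phaseCost q ≤ 208 * (5 * t) ^ 5 := Nat.mul_le_mul_left _ (Nat.pow_le_pow_left h1 5)
      _ = 650000 * t ^ 5 := by ring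
  have hm' : m ≤ K * n * t ^ K := hm
  have h6 : t ^ 6 ≤ t ^ (K + 6) := Nat.pow_le_pow_right ht1 (by omega)
  have hK : t ^ K ≤ t ^ (K + 6) := Nat.pow_le_pow_right ht1 (by omega)
  have h5 : t ^ 5 ≤ t ^ 6 := Nat.pow_le_pow_right ht1 (by omega)
  have h0 : 1 ≤ t ^ 6 := Nat.one_le_pow _ _ ht1
  have hX : (Nat.log 2 q + 1) * phaseCost q ≤ 650000 * t ^ 6 :=
    (Nat.mul_le_mul hlog hphase).trans (by apply le_of_eq; ring)
  -- The two Fourier transforms give the first double term and `6 * n`; the kinetic phase gives the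
  -- second double term and one further `n`.
  calc _ = 3 * m + 2 * (n * ((Nat.log 2 q + 1) * phaseCost q)) + 2 * (n * phaseCost q) +
        7 * n + 3 := by rw [hn]; ring
    _ ≤ 3 * (K * n * t ^ K) + 2 * (n * (650000 * t ^ 6)) + 2 * (n * (650000 * t ^ 5)) + 7 * n +
        3 * n := by gcongr; omega
    _ ≤ n * (3 * K * t ^ K + 2600000 * t ^ 6 + 10) := by
        have : n * t ^ 5 ≤ n * t ^ 6 := Nat.mul_le_mul_left _ h5
        nlinarith
    _ ≤ n * (3 * K * t ^ (K + 6) + 2600011 * t ^ (K + 6)) := by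
        refine Nat.mul_le_mul_left _ ?_
        have : 3 * K * t ^ K ≤ 3 * K * t ^ (K + 6) := Nat.mul_le_mul_left _ hK
        omega
    _ = softBound (2600011 + 3 * K) (K + 6) n := by
        rw [softBound, ← ht]
        ring

theorem softBound_mul_le {C k n R : ℕ} (hR : 1 ≤ R) :
    R * softBound C k n ≤ softBound C k (n * R) := by
  have h := one_add_log_le (Nat.le_mul_of_pos_right n hR)
  calc R * softBound C k n = C * (n * R) * (Nat.log 2 n + 1) ^ k := by rw [softBound]; ring
    _ ≤ softBound C k (n * R) := Nat.mul_le_mul_left _ (Nat.pow_le_pow_left h k)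

/-- The three terms are the preparation, the iterations and the measurement of `n` or fewer qubits.
-/
theorem softBound_add_le (C k K n : ℕ) :
    softBound K K n + softBound C (K + k) n + n ≤ softBound (C + K + 1) (K + k) n := by
  have h1 : (Nat.log 2 n + 1) ^ K ≤ (Nat.log 2 n + 1) ^ (K + k) :=
    Nat.pow_le_pow_right (by omega) (by omega)
  have h2 : n * 1 ≤ n * (Nat.log 2 n + 1) ^ (K + k) :=
    Nat.mul_le_mul_left _ (Nat.one_le_pow _ _ (by omega))
  have h3 := Nat.mul_le_mul_left (K * n) h1
  simp only [softBound, add_mul]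
  linarith

end QHD

/-! ### Assembly of the algorithm -/

theorem mainTheorem3 (K : ℕ) :
    ∃ C k : ℕ, ∀ d q m R : ℕ, 1 ≤ d → 1 ≤ q → 1 ≤ R →
      m ≤ QHD.softBound K K (d * q) →
      ∀ (a b δ s : ℝ) (φ χ : ℝ → ℝ), a < b → 0 < δ → 0 < s →
      ∃ w₀ : ℕ, ∀ w : ℕ, w₀ ≤ w →
      ∃ (pot kin : ℕ → QHD.Circuit d q m w) (ift ft : QHD.Circuit d q m w),
        -- the cost of one iteration, of all iterations, and the number of oracle queries
        (∀ j, QHD.gateCount (pot j ++ ift ++ kin j ++ ft) ≤ QHD.softBound C k (d * q)) ∧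
        QHD.gateCount (QHD.iterationCircuit pot kin ift ft R) ≤
          QHD.softBound C k (d * q * R) ∧
        (∀ j, QHD.queryCount (pot j) ≤ 2) ∧
        -- the circuits perform the operators of the update rule
        QHD.Implements ift (QHD.qsft d q)⁻¹ ∧
        QHD.Implements ft (QHD.qsft d q) ∧
        (∀ j, QHD.Implements (kin j) (QHD.kineticPhase d q a b s φ j)) ∧
        (∀ (f : (Fin d → ℝ) → ℝ) (F : QHD.MeshIndex d q → BitVec m) (η : ℝ),
          QHD.Evaluates F f a b δ η → ∀ (j : ℕ) (ψ : QHD.QState (Fin d × Fin q)),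
          ‖QHD.run F (pot j) (QHD.withZeros ψ) -
              QHD.withZeros (QHD.act (QHD.potentialPhase a b s χ f j) ψ)‖ ≤
            s * Real.exp (χ (j * s)) * η * ‖ψ‖) ∧
        -- the uniform superposition is prepared by `d * q` gates
        (∃ prep : QHD.Circuit d q m w, QHD.gateCount prep = d * q ∧
          ∀ F : QHD.MeshIndex d q → BitVec m,
            QHD.run F prep (QHD.zeroState (QHD.Qubit d q m w)) =
              QHD.withZeros (QHD.uniformState d q)) ∧
        -- the whole algorithm: preparation, `R` iterations, measurement of `d * q` qubits
        ∀ prep : QHD.Circuit d q m w, QHD.gateCount prep ≤ QHD.softBound K K (d * q * R) →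
          QHD.gateCount (prep ++ QHD.iterationCircuit pot kin ift ft R) + d * q ≤
            QHD.softBound C k (d * q * R) ∧
          ∀ (f : (Fin d → ℝ) → ℝ) (F : QHD.MeshIndex d q → BitVec m) (η : ℝ)
            (ψ₀ : QHD.QState (Fin d × Fin q)),
            QHD.Evaluates F f a b δ η →
            QHD.run F prep (QHD.zeroState (QHD.Qubit d q m w)) = QHD.withZeros ψ₀ →
            ‖QHD.run F (prep ++ QHD.iterationCircuit pot kin ift ft R)
                  (QHD.zeroState (QHD.Qubit d q m w)) -
                QHD.withZeros (QHD.iterate a b s φ χ f ψ₀ R)‖ ≤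
              ∑ j ∈ Finset.range R, s * Real.exp (χ (j * s)) * η ∧
            ∑ x, |QHD.outcomeProb
                    (QHD.run F (prep ++ QHD.iterationCircuit pot kin ift ft R)
                      (QHD.zeroState (QHD.Qubit d q m w))) x -
                  ‖QHD.iterate a b s φ χ f ψ₀ R x‖ ^ 2| ≤
              2 * ∑ j ∈ Finset.range R, s * Real.exp (χ (j * s)) * η := by
  refine ⟨2600011 + 3 * K + K + 1, K + 6, ?_⟩
  intro d q m R hd hq hR hm a b δ s φ χ _ _ hs
  refine ⟨QHD.workBound q, fun w hw => ?_⟩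
  obtain ⟨ft, hftc, hft⟩ := QHD.exists_implements_qsft (d := d) (m := m) hq hw
  choose kin hkinc hkin using
    fun j => QHD.exists_implements_kinetic (m := m) hd hq hw a b s φ j
  choose pot hpotc hpotq hpot using
    fun j => QHD.exists_implements_potential (d := d) (q := q) (m := m) (w := w) a b δ s hs χ j
  have hift := hft.inv
  set ift := QHD.invCircuit ft with hiftdef
  have hstep : ∀ j, (pot j ++ ift ++ kin j ++ ft).length ≤
      QHD.softBound (2600011 + 3 * K) (K + 6) (d * q) := fun j => by
    refine le_trans ?_ (QHD.iteration_cost_le hd hq hm)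
    simp only [List.length_append, hiftdef, QHD.length_invCircuit]
    have h1 := hkinc j
    have h2 := hpotc j
    omega
  have hall : (QHD.iterationCircuit pot kin ift ft R).length ≤
      QHD.softBound (2600011 + 3 * K) (K + 6) (d * q * R) :=
    (QHD.length_iterationCircuit_le hstep R).trans (QHD.softBound_mul_le hR)
  have hweak : ∀ n, QHD.softBound (2600011 + 3 * K) (K + 6) n ≤
      QHD.softBound (2600011 + 3 * K + K + 1) (K + 6) n := fun n =>
    le_trans (by omega) (QHD.softBound_add_le (2600011 + 3 * K) 6 K n)
  refine ⟨pot, kin, ift, ft, fun j => (hstep j).trans (hweak _), hall.trans (hweak _),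
    fun j => (hpotq j).le, hift, hft, hkin, fun f F η hF j ψ => hpot j f F η hF ψ,
    QHD.exists_uniform, fun prep hprep => ⟨?_, fun f F η ψ₀ hF hψ₀ => ?_⟩⟩
  · refine le_trans ?_ (QHD.softBound_add_le (2600011 + 3 * K) 6 K (d * q * R))
    rw [QHD.gateCount, List.length_append]
    have h1 : d * q ≤ d * q * R := Nat.le_mul_of_pos_right _ hR
    have h2 : prep.length ≤ QHD.softBound K K (d * q * R) := hprep
    omega
  -- The initial state is automatically normalized, because the preparation circuit preserves the
  -- norm.
  · have hzero : ‖QHD.zeroState (QHD.Qubit d q m w)‖ = 1 := by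
      simp [QHD.zeroState]
    have hnorm : ‖ψ₀‖ = 1 := by
      rw [← QHD.norm_withZeros (m := m) (w := w), ← hψ₀, QHD.norm_run, hzero]
    have herr := QHD.norm_run_iterationCircuit_sub_le (a := a) (b := b) (s := s) (φ := φ)
      (χ := χ) (f := f) hift hft hkin (fun j ψ => hpot j f F η hF ψ) hnorm R
    rw [← hψ₀, ← QHD.run_append] at herr
    refine ⟨herr, (QHD.sum_abs_outcomeProb_sub_le _ _).trans ?_⟩
    rw [QHD.norm_run, hzero, QHD.norm_iterate hift hft hkin, hnorm]
    linarith
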